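/- Let $L,E,I,H,q,E_c,A_c,L_c>0$ and let the sag-span ratio $n$ be given by $\frac{q}{H}=\frac{8n}{L}$. Let $p\in L^1[0,L]$ with $p\ge 0$ a.e. Consider the Melan equation $$EI\,w''''-\Big(H+\frac{E_cA_c}{L_c}\frac{q}{H}\int_0^L w\,dx\Big)w''+\frac{q^2}{H^2}\frac{E_cA_c}{L_c}\int_0^L w\,dx=p(x)\quad\text{for a.e. }x\in(0,L),\qquad(1)$$ $$w(0)=w(L)=w''(0)=w''(L)=0.\qquad(2)$$ A solution is a function $w\in W^{4,1}[0,L]$ satisfying (1), (2); a lower (upper) solution is a function $w\in W^{4,1}[0,L]$ satisfying (2) and (1) with "$=$" replaced by "$\le$" ("$\ge$"). Put $\beta(x)=\frac{L}{100}\sin\frac{\pi x}{L}$, $$[0,\beta]=\{u\in C^2[0,L]:\ 0\le u\le\beta,\ 0\ge u''\ge\beta''\text{ on }[0,L]\},$$ $$a=\frac{H}{EI},\quad b=\frac qH\frac{E_cA_c}{EI}\frac1{L_c},\quad c=\Big(\frac qH\Big)^2\frac{E_cA_c}{EI}\frac1{L_c},\quad \lambda=\frac{L}{100},$$ $$M=a+\frac{cL^3}{400n\pi}\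 \Big(=a+2b\lambda\frac L\pi\Big),\qquad N=c\Big(1+\frac{\pi^2}{800n}\Big)\ \Big(=c+b\lambda\frac{\pi^2}{L^2}\Big),\qquad \sigma(x)=\frac{3x^3}{6x\cosh x+6x-12\sinh x-x^3}.$$ Theorem 6.1. Assume that for a.e. $x\in(0,L)$ $$p(x)\le\Big[\frac{\pi^4}{100L^3}EI+\frac{H\pi^2}{100L}+\frac qH\frac{E_cA_c}{L_c}\frac{\pi L}{5000}\Big]\sin\frac{\pi x}{L}+2\Big(\frac qH\Big)^2\frac{E_cA_c}{L_c}\frac{L^2}{100\pi}.$$ Then $0$ is a lower solution and $\beta$ is an upper solution of (1), (2). If, moreover, $n\ge\frac1{15.32}$, $p$ is not a.e. equal to $0$, and $$N\le\frac{4M}{L^3}\,\sigma(\sqrt M L),$$ then (1), (2) has exactly one solution $y$ in $[0,\beta]$, and $y>0$ on $(0,L)$. The iterative procedure $$y_k''''-\Big(a+2b\lambda\frac L\pi\Big)y_k''+\Big(c+b\lambda\frac{\pi^2}{L^2}\Big)\int_0^L y_k =\frac{p}{EI}+b\,y_{k-1}''\int_0^L y_{k-1}-2b\lambda\frac L\pi\,y_{k-1}''+b\lambda\frac{\pi^2}{L^2}\int_0^L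 y_{k-1},$$ $y_k\in W^{4,1}[0,L]$, $y_k(0)=y_k(L)=y_k''(0)=y_k''(L)=0$ ($k\ge1$), with initial function $y_0=0$, respectively $y_0=\beta$, determines unique sequences $(\alpha_k)$, respectively $(\beta_k)$. On $[0,L]$ they satisfy $\alpha_k\le\alpha_{k+1}$, $\alpha_k\le\beta_k$, $\beta_{k+1}\le\beta_k$ and $\alpha_k''\ge\alpha_{k+1}''$, $\alpha_k''\ge\beta_k''$, $\beta_{k+1}''\ge\beta_k''$ for all $k\ge0$, and both converge to $y$ uniformly on $[0,L]$. -/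

import Mathlib

/-- The data of a suspension bridge: main span `L`, elastic modulus `E` and moment of inertia `I`
of the deck, horizontal cable tension `H` under the dead load `q`, and elastic modulus `Ec`,
cross-sectional area `Ac` and length `Lc` of the cable. -/
structure Bridge where
  (L E I H q Ec Ac Lc : ℝ)
  L_pos : 0 < L
  E_pos : 0 < E
  I_pos : 0 < I
  H_pos : 0 < H
  q_pos : 0 < q
  Ec_pos : 0 < Ec
  Ac_pos : 0 < Ac
  Lc_pos : 0 < Lc

/-- The `k`-th derivative on the closed interval `[0, L]` (one-sided at the end points).
Functions on `[0, L]` are represented by functions `ℝ → ℝ`; only their values on `[0, L]` matter. -/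
noncomputable def derivOn (L : ℝ) (k : ℕ) (u : ℝ → ℝ) : ℝ → ℝ :=
  iteratedDerivWithin k u (Set.Icc 0 L)

/-- `u ∈ W^{4,1}[0, L]`, given by its continuous representative: `u` is `C³` on `[0, L]` and its
third derivative is absolutely continuous there. The fourth derivative `derivOn L 4 u` then
exists almost everywhere and is integrable. -/
def IsW41 (L : ℝ) (u : ℝ → ℝ) : Prop :=
  ContDiffOn ℝ 3 u (Set.Icc 0 L) ∧ AbsolutelyContinuousOnInterval (derivOn L 3 u) 0 L

/-- The hinged (Navier) boundary conditions `u(0) = u(L) = u''(0) = u''(L) = 0`. -/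
def NavierBC (L : ℝ) (u : ℝ → ℝ) : Prop :=
  u 0 = 0 ∧ u L = 0 ∧ derivOn L 2 u 0 = 0 ∧ derivOn L 2 u L = 0

/-- The function `σ`. -/
noncomputable def melanSigma (x : ℝ) : ℝ :=
  3 * x ^ 3 / (6 * x * Real.cosh x + 6 * x - 12 * Real.sinh x - x ^ 3)

/-- The sector `[α, β]`: the `C²` functions `u` on `[0, L]` with `α ≤ u ≤ β` and
`α'' ≥ u'' ≥ β''` on `[0, L]`. -/
def sector (L : ℝ) (α β : ℝ → ℝ) : Set (ℝ → ℝ) :=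
  {u | ContDiffOn ℝ 2 u (Set.Icc 0 L) ∧
    ∀ x ∈ Set.Icc 0 L, α x ≤ u x ∧ u x ≤ β x ∧
      derivOn L 2 u x ≤ derivOn L 2 α x ∧ derivOn L 2 β x ≤ derivOn L 2 u x}

namespace Bridge

/-- The left-hand side of the Melan equation,
`EI w'''' - (H + (E_c A_c / L_c) (q / H) ∫₀ᴸ w) w'' + (q² / H²) (E_c A_c / L_c) ∫₀ᴸ w`. -/
noncomputable def melanLHS (B : Bridge) (w : ℝ → ℝ) (x : ℝ) : ℝ :=
  B.E * B.I * derivOn B.L 4 w x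
    - (B.H + B.Ec * B.Ac / B.Lc * (B.q / B.H) * ∫ t in (0 : ℝ)..B.L, w t) * derivOn B.L 2 w x
    + B.q ^ 2 / B.H ^ 2 * (B.Ec * B.Ac / B.Lc) * ∫ t in (0 : ℝ)..B.L, w t

/-- `w` solves the Melan boundary value problem with live load `p`. -/
def IsSolution (B : Bridge) (p w : ℝ → ℝ) : Prop :=
  IsW41 B.L w ∧ NavierBC B.L w ∧
    ∀ᵐ x ∂(MeasureTheory.volume.restrict (Set.Ioo 0 B.L)), B.melanLHS w x = p x

/-- `w` is a lower solution of the Melan boundary value problem with live load `p`. -/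
def IsLowerSolution (B : Bridge) (p w : ℝ → ℝ) : Prop :=
  IsW41 B.L w ∧ NavierBC B.L w ∧
    ∀ᵐ x ∂(MeasureTheory.volume.restrict (Set.Ioo 0 B.L)), B.melanLHS w x ≤ p x

/-- `w` is an upper solution of the Melan boundary value problem with live load `p`. -/
def IsUpperSolution (B : Bridge) (p w : ℝ → ℝ) : Prop :=
  IsW41 B.L w ∧ NavierBC B.L w ∧
    ∀ᵐ x ∂(MeasureTheory.volume.restrict (Set.Ioo 0 B.L)), p x ≤ B.melanLHS w x

/-- The coefficient `a` of the equation divided by `EI`. -/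
noncomputable def a (B : Bridge) : ℝ := B.H / (B.E * B.I)

/-- The coefficient `b` of the equation divided by `EI`. -/
noncomputable def b (B : Bridge) : ℝ := B.q / B.H * (B.Ec * B.Ac / (B.E * B.I)) * (1 / B.Lc)

/-- The coefficient `c` of the equation divided by `EI`. -/
noncomputable def c (B : Bridge) : ℝ :=
  (B.q / B.H) ^ 2 * (B.Ec * B.Ac / (B.E * B.I)) * (1 / B.Lc)

/-- The amplitude `λ = L / 100`. -/
noncomputable def lam (B : Bridge) : ℝ := B.L / 100

/-- The function `(L / 100) sin (π x / L)`. -/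
noncomputable def beta (B : Bridge) (x : ℝ) : ℝ := B.lam * Real.sin (Real.pi / B.L * x)

/-- `v` is obtained from `u` by one step of the iteration: `v ∈ W^{4,1}[0, L]` satisfies the
boundary conditions and
`v'''' - (a + 2bλL/π) v'' + (c + bλπ²/L²) ∫₀ᴸ v
  = p/(EI) + b u'' ∫₀ᴸ u - (2bλL/π) u'' + (bλπ²/L²) ∫₀ᴸ u`. -/
def IsStep (B : Bridge) (p u v : ℝ → ℝ) : Prop :=
  IsW41 B.L v ∧ NavierBC B.L v ∧
    ∀ᵐ x ∂(MeasureTheory.volume.restrict (Set.Ioo 0 B.L)),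
      derivOn B.L 4 v x
          - (B.a + 2 * B.b * B.lam * (B.L / Real.pi)) * derivOn B.L 2 v x
          + (B.c + B.b * B.lam * (Real.pi ^ 2 / B.L ^ 2)) * ∫ t in (0 : ℝ)..B.L, v t
        = p x / (B.E * B.I)
          + B.b * derivOn B.L 2 u x * (∫ t in (0 : ℝ)..B.L, u t)
          - 2 * B.b * B.lam * (B.L / Real.pi) * derivOn B.L 2 u x
          + B.b * B.lam * (Real.pi ^ 2 / B.L ^ 2) * ∫ t in (0 : ℝ)..B.L, u t

/-- `y` is a sequence of iterates starting at `y₀`. -/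
def IsIteration (B : Bridge) (p y₀ : ℝ → ℝ) (y : ℕ → ℝ → ℝ) : Prop :=
  Set.EqOn (y 0) y₀ (Set.Icc 0 B.L) ∧ ∀ k, B.IsStep p (y k) (y (k + 1))

/-- `y` is the sequence of iterates starting at `y₀`: it is one, and every other one has the
same values on `[0, L]`. -/
def IsTheIteration (B : Bridge) (p y₀ : ℝ → ℝ) (y : ℕ → ℝ → ℝ) : Prop :=
  B.IsIteration p y₀ y ∧
    ∀ z, B.IsIteration p y₀ z → ∀ k, Set.EqOn (z k) (y k) (Set.Icc 0 B.L)

end Bridge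

/-!
Let `R` be the Green operator of `-v'' = g` with zero Dirichlet data. A function
`u ∈ W^{4,1}` with hinged ends and `h = u''''` is `u = R R h` with `u'' = -R h`, so that
`f = u'''' - M u'' + N ∫ u` is `h + M R h + N J` with `J = ∫ R R h`. Inverting `1 + M R` gives
`R h = R (1 + M R)⁻¹ f - N J e` with `e = (1 + M R)⁻¹ R 1`, and symmetry of `R` gives
`(1 + N ∫ R e) J = ∫ (R e) f`. Hence `f ≥ 0` forces `u'' ≤ 0 ≤ u` once `N` times the rank-one
kernel `e ⊗ R e` is at most `1 + N ∫ R e` times the Green kernel of `-v'' + M v`; an explicit bound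
for the ratio of the two kernels turns this into the hypothesis on `σ`.

By this maximum principle the iteration is monotone for the order `u ≤ v`, `u'' ≥ v''` and stays
between the lower solution `0` and the upper solution `β`. The second derivatives and the integrals
of the iterates are therefore monotone and bounded, hence convergent; the fourth derivatives, being
continuous expressions in these, converge dominatedly, and the limit is a solution. Of two solutions
the one with the smaller integral is the larger one, by the maximum principle with `N = 0`, whence
uniqueness.
-/

open MeasureTheory Set Filter Topology

/-! ### The Green operator of the Dirichlet problem -/

section AbsoluteContinuity

variable {f f' g : ℝ → ℝ} {a b : ℝ}

lemma intervalIntegrable_of_locallyIntegrable (hg : LocallyIntegrable g) :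
    IntervalIntegrable g volume a b :=
  (hg.integrableOn_isCompact isCompact_uIcc).intervalIntegrable

lemma absolutelyContinuousOnInterval_congr (hf : AbsolutelyContinuousOnInterval f a b)
    (h : EqOn f g (uIcc a b)) : AbsolutelyContinuousOnInterval g a b := by
  rw [absolutelyContinuousOnInterval_iff] at hf ⊢
  intro ε hε
  obtain ⟨δ, hδ, hsum⟩ := hf ε hε
  refine ⟨δ, hδ, fun E hE hlen => ?_⟩
  have hlt := hsum E hE hlen
  rwa [Finset.sum_congr rfl fun i hi => by rw [h (hE.1 i hi).1, h (hE.1 i hi).2]] at hlt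

lemma absolutelyContinuousOnInterval_of_hasDerivAt (hf : ∀ x, HasDerivAt f (f' x) x)
    (hf' : Continuous f') : AbsolutelyContinuousOnInterval f a b := by
  have hderiv : deriv f = f' := funext fun x => (hf x).deriv
  exact (contDiff_one_iff_deriv.2 ⟨fun x => (hf x).differentiableAt,
    hderiv ▸ hf'⟩).contDiffOn.absolutelyContinuousOnInterval

lemma absolutelyContinuousOnInterval_primitive (hg : LocallyIntegrable g) (c : ℝ) :
    AbsolutelyContinuousOnInterval (fun x => ∫ s in c..x, g s) a b := by
  have hint {x y : ℝ} : IntervalIntegrable g volume x y :=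
    intervalIntegrable_of_locallyIntegrable hg
  have hac : AbsolutelyContinuousOnInterval (fun x => ∫ s in a..x, g s) a b :=
    hint.absolutelyContinuousOnInterval_intervalIntegral left_mem_uIcc
  refine absolutelyContinuousOnInterval_congr
    ((absolutelyContinuousOnInterval_of_hasDerivAt (fun x => hasDerivAt_const x (∫ s in c..a, g s))
      continuous_const).fun_add hac) fun x _ => ?_
  exact intervalIntegral.integral_add_adjacent_intervals hint hint

lemma integral_eq_sub_of_absolutelyContinuous (hab : a ≤ b)
    (hf : AbsolutelyContinuousOnInterval f a b)
    (h : ∀ᵐ x ∂volume.restrict (Ioo a b), HasDerivAt f (f' x) x) :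
    ∫ x in a..b, f' x = f b - f a := by
  rw [← hf.integral_deriv_eq_sub]
  refine intervalIntegral.integral_congr_ae_restrict ?_
  rw [uIoc_of_le hab, ← restrict_Ioo_eq_restrict_Ioc]
  exact h.mono fun x hx => hx.deriv.symm

end AbsoluteContinuity

lemma continuous_primitive_of_locallyIntegrable {g : ℝ → ℝ} (hg : LocallyIntegrable g) :
    Continuous fun x => ∫ s in (0 : ℝ)..x, g s :=
  intervalIntegral.continuous_primitive (fun _ _ => intervalIntegrable_of_locallyIntegrable hg) 0

/-- The solution `v` of the Dirichlet problem `-v'' = g`, `v 0 = v L = 0`. -/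
noncomputable def dirichletInv (L : ℝ) (g : ℝ → ℝ) (x : ℝ) : ℝ :=
  x / L * (∫ t in (0 : ℝ)..L, ∫ s in (0 : ℝ)..t, g s) - ∫ t in (0 : ℝ)..x, ∫ s in (0 : ℝ)..t, g s

/-- The derivative of `dirichletInv L g`. -/
noncomputable def dirichletInvDeriv (L : ℝ) (g : ℝ → ℝ) (x : ℝ) : ℝ :=
  (∫ t in (0 : ℝ)..L, ∫ s in (0 : ℝ)..t, g s) / L - ∫ s in (0 : ℝ)..x, g s

section DirichletInv

variable {L : ℝ} {f g : ℝ → ℝ}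

lemma hasDerivAt_dirichletInv (L : ℝ) (hg : LocallyIntegrable g) (x : ℝ) :
    HasDerivAt (dirichletInv L g) (dirichletInvDeriv L g x) x := by
  have hc := continuous_primitive_of_locallyIntegrable hg
  refine ((((hasDerivAt_id x).div_const L).mul_const _).sub
    (hc.integral_hasStrictDerivAt 0 x).hasDerivAt).congr_deriv ?_
  rw [dirichletInvDeriv]
  ring

lemma continuous_dirichletInv (L : ℝ) (hg : LocallyIntegrable g) :
    Continuous (dirichletInv L g) :=
  continuous_iff_continuousAt.2 fun x => (hasDerivAt_dirichletInv L hg x).continuousAt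

lemma continuous_dirichletInvDeriv (L : ℝ) (hg : LocallyIntegrable g) :
    Continuous (dirichletInvDeriv L g) :=
  continuous_const.sub (continuous_primitive_of_locallyIntegrable hg)

lemma ae_hasDerivAt_dirichletInvDeriv (L : ℝ) (hg : LocallyIntegrable g) :
    ∀ᵐ x, HasDerivAt (dirichletInvDeriv L g) (-g x) x :=
  (LocallyIntegrable.ae_hasDerivAt_integral hg).mono fun _ hx => (hx 0).const_sub _

lemma hasDerivAt_dirichletInvDeriv (L : ℝ) (hg : Continuous g) (x : ℝ) :
    HasDerivAt (dirichletInvDeriv L g) (-g x) x :=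
  (hg.integral_hasStrictDerivAt 0 x).hasDerivAt.const_sub _

lemma absolutelyContinuous_dirichletInvDeriv (L : ℝ) (hg : LocallyIntegrable g) (a b : ℝ) :
    AbsolutelyContinuousOnInterval (dirichletInvDeriv L g) a b :=
  (absolutelyContinuousOnInterval_of_hasDerivAt (fun x => hasDerivAt_const x _)
    continuous_const).fun_sub (absolutelyContinuousOnInterval_primitive hg 0)

lemma dirichletInv_zero_left (L : ℝ) (g : ℝ → ℝ) : dirichletInv L g 0 = 0 := by
  simp [dirichletInv]

lemma dirichletInv_zero_right (hL : 0 < L) (g : ℝ → ℝ) : dirichletInv L g L = 0 := by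
  simp [dirichletInv, hL.ne']

lemma primitive_congr_ae (h : f =ᵐ[volume.restrict (Ioo 0 L)] g) {x : ℝ} (hx : x ∈ Icc 0 L) :
    ∫ s in (0 : ℝ)..x, f s = ∫ s in (0 : ℝ)..x, g s := by
  refine intervalIntegral.integral_congr_ae_restrict ?_
  rw [uIoc_of_le hx.1]
  rw [restrict_Ioo_eq_restrict_Ioc] at h
  exact ae_restrict_of_ae_restrict_of_subset (Ioc_subset_Ioc_right hx.2) h

lemma dirichletInv_congr_ae (h : f =ᵐ[volume.restrict (Ioo 0 L)] g) :
    EqOn (dirichletInv L f) (dirichletInv L g) (Icc 0 L) := by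
  have double_primitive_congr {y : ℝ} (hy : y ∈ Icc 0 L) :
      ∫ t in (0 : ℝ)..y, ∫ s in (0 : ℝ)..t, f s = ∫ t in (0 : ℝ)..y, ∫ s in (0 : ℝ)..t, g s := by
    refine intervalIntegral.integral_congr fun t ht => ?_
    rw [uIcc_of_le hy.1] at ht
    exact primitive_congr_ae h ⟨ht.1, ht.2.trans hy.2⟩
  intro x hx
  rw [dirichletInv, dirichletInv, double_primitive_congr hx,
    double_primitive_congr (right_mem_Icc.2 (hx.1.trans hx.2))]

lemma dirichletInv_congr (h : EqOn f g (Icc 0 L)) :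
    EqOn (dirichletInv L f) (dirichletInv L g) (Icc 0 L) :=
  dirichletInv_congr_ae <| ae_restrict_of_forall_mem measurableSet_Ioo
    fun _ hx => h (Ioo_subset_Icc_self hx)

lemma dirichletInv_sub (L : ℝ) (hf : LocallyIntegrable f) (hg : LocallyIntegrable g) (x : ℝ) :
    dirichletInv L (fun s => f s - g s) x = dirichletInv L f x - dirichletInv L g x := by
  have double_primitive_sub (y : ℝ) : ∫ t in (0 : ℝ)..y, ∫ s in (0 : ℝ)..t, (f s - g s) =
      (∫ t in (0 : ℝ)..y, ∫ s in (0 : ℝ)..t, f s) - ∫ t in (0 : ℝ)..y, ∫ s in (0 : ℝ)..t, g s := by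
    rw [← intervalIntegral.integral_sub
      ((continuous_primitive_of_locallyIntegrable hf).intervalIntegrable _ _)
      ((continuous_primitive_of_locallyIntegrable hg).intervalIntegrable _ _)]
    exact intervalIntegral.integral_congr fun t _ => intervalIntegral.integral_sub
      (intervalIntegrable_of_locallyIntegrable hf) (intervalIntegrable_of_locallyIntegrable hg)
  simp only [dirichletInv, double_primitive_sub]
  ring

lemma dirichletInv_const_mul (L c : ℝ) (g : ℝ → ℝ) (x : ℝ) :
    dirichletInv L (fun s => c * g s) x = c * dirichletInv L g x := by
  simp only [dirichletInv, intervalIntegral.integral_const_mul]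
  ring

lemma concaveOn_dirichletInv (hg : LocallyIntegrable g)
    (h : ∀ᵐ x ∂volume.restrict (Ioo 0 L), 0 ≤ g x) : ConcaveOn ℝ (Icc 0 L) (dirichletInv L g) := by
  refine AntitoneOn.concaveOn_of_deriv (convex_Icc 0 L) (continuous_dirichletInv L hg).continuousOn
    (fun x _ => (hasDerivAt_dirichletInv L hg x).differentiableAt.differentiableWithinAt) ?_
  rw [interior_Icc]
  intro x hx y hy hxy
  rw [(hasDerivAt_dirichletInv L hg x).deriv, (hasDerivAt_dirichletInv L hg y).deriv,
    dirichletInvDeriv, dirichletInvDeriv, ← intervalIntegral.integral_add_adjacent_intervals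
    (intervalIntegrable_of_locallyIntegrable hg (a := 0) (b := x))
    (intervalIntegrable_of_locallyIntegrable hg (a := x) (b := y))]
  have hxy_nonneg : 0 ≤ ∫ s in x..y, g s := by
    refine intervalIntegral.integral_nonneg_of_ae_restrict hxy ?_
    exact ae_restrict_of_ae_restrict_of_subset (Icc_subset_Ioo hx.1 hy.2) h
  linarith

lemma dirichletInv_nonneg (hg : LocallyIntegrable g)
    (h : ∀ᵐ x ∂volume.restrict (Ioo 0 L), 0 ≤ g x) {x : ℝ} (hx : x ∈ Icc 0 L) :
    0 ≤ dirichletInv L g x := by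
  rcases (hx.1.trans hx.2).eq_or_lt with rfl | hL
  · rw [show x = 0 from le_antisymm hx.2 hx.1, dirichletInv_zero_left]
  have hmin := (concaveOn_dirichletInv hg h).min_le_of_mem_Icc (left_mem_Icc.2 hL.le)
    (right_mem_Icc.2 hL.le) hx
  simpa [dirichletInv_zero_left, dirichletInv_zero_right hL] using hmin

lemma eqOn_dirichletInv_of_ae_hasDerivAt (hL : 0 < L) {v d : ℝ → ℝ}
    (hv : AbsolutelyContinuousOnInterval v 0 L) (hd : AbsolutelyContinuousOnInterval d 0 L)
    (hvd : ∀ᵐ x ∂volume.restrict (Ioo 0 L), HasDerivAt v (d x) x)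
    (hdg : ∀ᵐ x ∂volume.restrict (Ioo 0 L), HasDerivAt d (-g x) x)
    (h0 : v 0 = 0) (h1 : v L = 0) : EqOn v (dirichletInv L g) (Icc 0 L) := by
  have ftc {f f' : ℝ → ℝ} (hf : AbsolutelyContinuousOnInterval f 0 L)
      (hff' : ∀ᵐ x ∂volume.restrict (Ioo 0 L), HasDerivAt f (f' x) x) {x : ℝ}
      (hx : x ∈ Icc 0 L) : ∫ s in (0 : ℝ)..x, f' s = f x - f 0 := by
    refine integral_eq_sub_of_absolutelyContinuous hx.1 (hf.mono ?_)
      (ae_restrict_of_ae_restrict_of_subset (Ioo_subset_Ioo_right hx.2) hff')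
    rw [uIcc_of_le hx.1, uIcc_of_le hL.le]
    exact Icc_subset_Icc_right hx.2
  have hd_eq {x : ℝ} (hx : x ∈ Icc 0 L) : ∫ s in (0 : ℝ)..x, g s = d 0 - d x := by
    have := ftc hd hdg hx
    rw [intervalIntegral.integral_neg] at this
    linarith
  have hv_eq {x : ℝ} (hx : x ∈ Icc 0 L) :
      ∫ t in (0 : ℝ)..x, ∫ s in (0 : ℝ)..t, g s = d 0 * x - v x := by
    have hdint : IntervalIntegrable d volume 0 x := by
      refine (hd.continuousOn.mono ?_).intervalIntegrable
      rw [uIcc_of_le hx.1, uIcc_of_le hL.le]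
      exact Icc_subset_Icc_right hx.2
    rw [intervalIntegral.integral_congr (g := fun t => d 0 - d t), intervalIntegral.integral_sub
      intervalIntegrable_const hdint, ftc hv hvd hx, h0]
    · simp [mul_comm]
    · intro t ht
      rw [uIcc_of_le hx.1] at ht
      exact hd_eq ⟨ht.1, ht.2.trans hx.2⟩
  intro x hx
  rw [dirichletInv, hv_eq hx, hv_eq (right_mem_Icc.2 hL.le), h1]
  field_simp
  ring

lemma green_formula (L : ℝ) (hg : LocallyIntegrable g) {θ θ' θ'' : ℝ → ℝ}
    (hθ : ∀ x, HasDerivAt θ (θ' x) x) (hθ' : ∀ x, HasDerivAt θ' (θ'' x) x)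
    (hθ'' : Continuous θ'') {a b : ℝ} (hab : a ≤ b) :
    ∫ s in a..b, (θ s * g s + θ'' s * dirichletInv L g s) =
      (θ' b * dirichletInv L g b - θ b * dirichletInvDeriv L g b) -
      (θ' a * dirichletInv L g a - θ a * dirichletInvDeriv L g a) := by
  have hθ'c : Continuous θ' := continuous_iff_continuousAt.2 fun x => (hθ' x).continuousAt
  have hac : AbsolutelyContinuousOnInterval
      (fun x => θ' x * dirichletInv L g x - θ x * dirichletInvDeriv L g x) a b :=
    ((absolutelyContinuousOnInterval_of_hasDerivAt hθ' hθ'').fun_mul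
      (absolutelyContinuousOnInterval_of_hasDerivAt (hasDerivAt_dirichletInv L hg)
        (continuous_dirichletInvDeriv L hg))).fun_sub
    ((absolutelyContinuousOnInterval_of_hasDerivAt hθ hθ'c).fun_mul
      (absolutelyContinuous_dirichletInvDeriv L hg a b))
  refine integral_eq_sub_of_absolutelyContinuous hab hac (ae_restrict_of_ae ?_)
  filter_upwards [ae_hasDerivAt_dirichletInvDeriv L hg] with x hx
  exact (((hθ' x).mul (hasDerivAt_dirichletInv L hg x)).sub ((hθ x).mul hx)).congr_deriv (by ring)

lemma integral_dirichletInv_mul (hL : 0 < L) (hf : Continuous f) (hg : LocallyIntegrable g) :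
    ∫ s in (0 : ℝ)..L, dirichletInv L f s * g s = ∫ s in (0 : ℝ)..L, f s * dirichletInv L g s := by
  have hgreen := green_formula L hg (hasDerivAt_dirichletInv L hf.locallyIntegrable)
    (hasDerivAt_dirichletInvDeriv L hf) hf.neg hL.le
  simp only [dirichletInv_zero_left, dirichletInv_zero_right hL, mul_zero, zero_mul, sub_zero,
    neg_mul] at hgreen
  rw [← sub_eq_zero, ← intervalIntegral.integral_sub]
  · simpa only [sub_eq_add_neg] using hgreen
  · exact (intervalIntegrable_of_locallyIntegrable hg).continuousOn_mul
      (continuous_dirichletInv L hf.locallyIntegrable).continuousOn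
  · exact (hf.mul (continuous_dirichletInv L hg)).intervalIntegrable _ _

end DirichletInv

lemma derivOn_zero (L : ℝ) (u : ℝ → ℝ) : derivOn L 0 u = u := iteratedDerivWithin_zero

/-! ### Hinged functions as iterated Green potentials -/

section DerivOn

variable {L : ℝ} {u v : ℝ → ℝ}

lemma derivOn_congr (h : EqOn u v (Icc 0 L)) (k : ℕ) :
    EqOn (derivOn L k u) (derivOn L k v) (Icc 0 L) :=
  iteratedDerivWithin_congr h

lemma derivOn_succ (L : ℝ) (k : ℕ) (u : ℝ → ℝ) (x : ℝ) :
    derivOn L (k + 1) u x = derivWithin (derivOn L k u) (Icc 0 L) x := by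
  rw [derivOn, iteratedDerivWithin_succ]
  rfl

lemma derivOn_succ_of_hasDerivAt (hL : 0 < L) {k : ℕ} {g : ℝ → ℝ} {g' x : ℝ}
    (hx : x ∈ Icc 0 L) (hug : EqOn (derivOn L k u) g (Icc 0 L)) (hg : HasDerivAt g g' x) :
    derivOn L (k + 1) u x = g' := by
  rw [derivOn_succ, derivWithin_congr hug (hug hx)]
  exact hg.hasDerivWithinAt.derivWithin (uniqueDiffOn_Icc hL x hx)

lemma derivOn_eq_iteratedDeriv (hL : 0 < L) {k : ℕ} (hu : ContDiff ℝ k u) :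
    EqOn (derivOn L k u) (iteratedDeriv k u) (Icc 0 L) :=
  fun _ hx => iteratedDerivWithin_eq_iteratedDeriv (uniqueDiffOn_Icc hL) hu.contDiffAt hx

lemma contDiffOn_derivOn (hL : 0 < L) {k : ℕ} (hu : ContDiffOn ℝ (k + 1 : ℕ) u (Icc 0 L)) :
    ContDiffOn ℝ 1 (derivOn L k u) (Icc 0 L) :=
  ((contDiffOn_nat_succ_iff_contDiffOn_one_iteratedDerivWithin (uniqueDiffOn_Icc hL)).1 hu).2

lemma isW41_of_contDiff (hL : 0 < L) (hu : ContDiff ℝ 4 u) : IsW41 L u := by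
  have hu3 : ContDiffOn ℝ 1 (derivOn L 3 u) (Icc 0 L) :=
    contDiffOn_derivOn hL (by exact_mod_cast hu.contDiffOn)
  rw [← uIcc_of_le hL.le] at hu3
  exact ⟨(hu.of_le (by norm_num)).contDiffOn, hu3.absolutelyContinuousOnInterval⟩

namespace IsW41

lemma absolutelyContinuous_derivOn (hu : IsW41 L u) (hL : 0 < L) {k : ℕ} (hk : k ≤ 3) :
    AbsolutelyContinuousOnInterval (derivOn L k u) 0 L := by
  rcases hk.eq_or_lt with rfl | hk
  · exact hu.2
  have huk : ContDiffOn ℝ 1 (derivOn L k u) (Icc 0 L) :=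
    contDiffOn_derivOn hL (hu.1.of_le (by exact_mod_cast hk))
  rw [← uIcc_of_le hL.le] at huk
  exact huk.absolutelyContinuousOnInterval

lemma continuousOn_derivOn (hu : IsW41 L u) (hL : 0 < L) {k : ℕ} (hk : k ≤ 3) :
    ContinuousOn (derivOn L k u) (Icc 0 L) :=
  uIcc_of_le hL.le ▸ (hu.absolutelyContinuous_derivOn hL hk).continuousOn

lemma ae_hasDerivAt_derivOn (hu : IsW41 L u) (hL : 0 < L) {k : ℕ} (hk : k ≤ 3) :
    ∀ᵐ x ∂volume.restrict (Ioo 0 L), HasDerivAt (derivOn L k u) (derivOn L (k + 1) u x) x := by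
  rw [ae_restrict_iff' measurableSet_Ioo]
  filter_upwards [(hu.absolutelyContinuous_derivOn hL hk).ae_differentiableAt] with x hx hxL
  have hxmem : x ∈ uIcc 0 L := uIcc_of_le hL.le ▸ Ioo_subset_Icc_self hxL
  rw [derivOn_succ, derivWithin_of_mem_nhds (Icc_mem_nhds hxL.1 hxL.2)]
  exact (hx hxmem).hasDerivAt

lemma integrableOn_derivOn_four (hu : IsW41 L u) (hL : 0 < L) :
    IntegrableOn (derivOn L 4 u) (Ioo 0 L) := by
  have hint := (hu.absolutelyContinuous_derivOn hL le_rfl).intervalIntegrable_deriv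
  rw [intervalIntegrable_iff_integrableOn_Ioo_of_le hL.le] at hint
  exact hint.congr ((hu.ae_hasDerivAt_derivOn hL le_rfl).mono fun x hx => hx.deriv)

lemma continuousOn (hu : IsW41 L u) : ContinuousOn u (Icc 0 L) := hu.1.continuousOn

lemma intervalIntegrable (hu : IsW41 L u) (hL : 0 ≤ L) : IntervalIntegrable u volume 0 L :=
  hu.continuousOn.intervalIntegrable_of_Icc hL

lemma sub (hu : IsW41 L u) (hv : IsW41 L v) (hL : 0 < L) : IsW41 L (u - v) := by
  refine ⟨hu.1.sub hv.1, absolutelyContinuousOnInterval_congr (hu.2.sub hv.2) fun x hx => ?_⟩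
  rw [uIcc_of_le hL.le] at hx
  exact (iteratedDerivWithin_sub hx (uniqueDiffOn_Icc hL) (hu.1 x hx) (hv.1 x hx)).symm

lemma derivOn_two_sub (hu : IsW41 L u) (hv : IsW41 L v) (hL : 0 < L) {x : ℝ} (hx : x ∈ Icc 0 L) :
    derivOn L 2 (u - v) x = derivOn L 2 u x - derivOn L 2 v x :=
  iteratedDerivWithin_sub hx (uniqueDiffOn_Icc hL) ((hu.1 x hx).of_le (by norm_num))
    ((hv.1 x hx).of_le (by norm_num))

lemma derivOn_four_sub (hu : IsW41 L u) (hv : IsW41 L v) (hL : 0 < L) :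
    ∀ᵐ x ∂volume.restrict (Ioo 0 L),
      derivOn L 4 (u - v) x = derivOn L 4 u x - derivOn L 4 v x := by
  filter_upwards [hu.ae_hasDerivAt_derivOn hL le_rfl, hv.ae_hasDerivAt_derivOn hL le_rfl,
    ae_restrict_mem measurableSet_Ioo] with x hux hvx hx
  refine derivOn_succ_of_hasDerivAt hL (Ioo_subset_Icc_self hx) (fun y hy => ?_) (hux.sub hvx)
  exact iteratedDerivWithin_sub hy (uniqueDiffOn_Icc hL) (hu.1 y hy) (hv.1 y hy)

lemma integral_sub (hu : IsW41 L u) (hv : IsW41 L v) (hL : 0 ≤ L) :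
    ∫ x in (0 : ℝ)..L, (u - v) x = (∫ x in (0 : ℝ)..L, u x) - ∫ x in (0 : ℝ)..L, v x :=
  intervalIntegral.integral_sub (hu.intervalIntegrable hL) (hv.intervalIntegrable hL)

lemma navierBC_sub (hu : IsW41 L u) (hv : IsW41 L v) (hL : 0 < L) (bu : NavierBC L u)
    (bv : NavierBC L v) : NavierBC L (u - v) := by
  obtain ⟨hu0, huL, hu0'', huL''⟩ := bu
  obtain ⟨hv0, hvL, hv0'', hvL''⟩ := bv
  refine ⟨by simp [hu0, hv0], by simp [huL, hvL], ?_, ?_⟩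
  · rw [hu.derivOn_two_sub hv hL (left_mem_Icc.2 hL.le), hu0'', hv0'', sub_zero]
  · rw [hu.derivOn_two_sub hv hL (right_mem_Icc.2 hL.le), huL'', hvL'', sub_zero]

end IsW41

end DerivOn

section NavierGreenOperator

variable {L : ℝ} {u h : ℝ → ℝ}

lemma derivOn_two_dirichletInv (hL : 0 < L) {g : ℝ → ℝ} (hg : Continuous g) :
    EqOn (derivOn L 2 (dirichletInv L g)) (-g) (Icc 0 L) := by
  have hone : EqOn (derivOn L 1 (dirichletInv L g)) (dirichletInvDeriv L g) (Icc 0 L) :=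
    fun x hx => derivOn_succ_of_hasDerivAt hL hx (derivOn_zero L _ ▸ eqOn_refl _ _)
      (hasDerivAt_dirichletInv L hg.locallyIntegrable x)
  exact fun x hx => derivOn_succ_of_hasDerivAt hL hx hone (hasDerivAt_dirichletInvDeriv L hg x)

lemma derivOn_three_dirichletInv_dirichletInv (hL : 0 < L) (hh : LocallyIntegrable h) :
    EqOn (derivOn L 3 (dirichletInv L (dirichletInv L h))) (-dirichletInvDeriv L h) (Icc 0 L) :=
  fun x hx => derivOn_succ_of_hasDerivAt hL hx
    (derivOn_two_dirichletInv hL (continuous_dirichletInv L hh))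
    (hasDerivAt_dirichletInv L hh x).neg

lemma derivOn_four_dirichletInv_dirichletInv (hL : 0 < L) (hh : LocallyIntegrable h) :
    derivOn L 4 (dirichletInv L (dirichletInv L h)) =ᵐ[volume.restrict (Ioo 0 L)] h := by
  filter_upwards [ae_restrict_of_ae (ae_hasDerivAt_dirichletInvDeriv L hh),
    ae_restrict_mem measurableSet_Ioo] with x hx hxL
  refine derivOn_succ_of_hasDerivAt hL (Ioo_subset_Icc_self hxL)
    (derivOn_three_dirichletInv_dirichletInv hL hh) ?_
  exact hx.neg.congr_deriv (neg_neg _)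

lemma contDiff_dirichletInv_dirichletInv (L : ℝ) (hh : LocallyIntegrable h) :
    ContDiff ℝ 3 (dirichletInv L (dirichletInv L h)) := by
  have contDiff_succ {n : ℕ} {f f' : ℝ → ℝ} (hf : ∀ x, HasDerivAt f (f' x) x)
      (hf' : ContDiff ℝ n f') : ContDiff ℝ (n + 1 : ℕ) f := by
    rw [← funext fun x => (hf x).deriv] at hf'
    exact_mod_cast contDiff_succ_iff_deriv.2
      ⟨fun x => (hf x).differentiableAt, by simp, hf'⟩
  have hc := continuous_dirichletInv L hh
  exact contDiff_succ (n := 2) (hasDerivAt_dirichletInv L hc.locallyIntegrable) <|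
    contDiff_succ (n := 1) (hasDerivAt_dirichletInvDeriv L hc) <| ContDiff.neg <|
    contDiff_succ (n := 0) (hasDerivAt_dirichletInv L hh) <|
    contDiff_zero.2 (continuous_dirichletInvDeriv L hh)

lemma isW41_dirichletInv_dirichletInv (hL : 0 < L) (hh : LocallyIntegrable h) :
    IsW41 L (dirichletInv L (dirichletInv L h)) := by
  refine ⟨(contDiff_dirichletInv_dirichletInv L hh).contDiffOn,
    absolutelyContinuousOnInterval_congr (absolutelyContinuous_dirichletInvDeriv L hh 0 L).neg ?_⟩
  rw [uIcc_of_le hL.le]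
  exact (derivOn_three_dirichletInv_dirichletInv hL hh).symm

lemma navierBC_dirichletInv_dirichletInv (hL : 0 < L) (hh : LocallyIntegrable h) :
    NavierBC L (dirichletInv L (dirichletInv L h)) := by
  have htwo := derivOn_two_dirichletInv hL (continuous_dirichletInv L hh)
  refine ⟨dirichletInv_zero_left _ _, dirichletInv_zero_right hL _, ?_, ?_⟩
  · rw [htwo (left_mem_Icc.2 hL.le), Pi.neg_apply, dirichletInv_zero_left, neg_zero]
  · rw [htwo (right_mem_Icc.2 hL.le), Pi.neg_apply, dirichletInv_zero_right hL, neg_zero]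

/-- The fourth derivative on `(0, L)`, extended by `0` to a function on the line. -/
noncomputable def fourthDeriv (L : ℝ) (u : ℝ → ℝ) : ℝ → ℝ :=
  (Ioo 0 L).indicator (derivOn L 4 u)

lemma fourthDeriv_ae_eq (L : ℝ) (u : ℝ → ℝ) :
    fourthDeriv L u =ᵐ[volume.restrict (Ioo 0 L)] derivOn L 4 u :=
  indicator_ae_eq_restrict measurableSet_Ioo

namespace IsW41

lemma locallyIntegrable_fourthDeriv (hu : IsW41 L u) (hL : 0 < L) :
    LocallyIntegrable (fourthDeriv L u) :=
  ((integrable_indicator_iff measurableSet_Ioo).2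
    (hu.integrableOn_derivOn_four hL)).locallyIntegrable

lemma derivOn_two_eq (hu : IsW41 L u) (hL : 0 < L) (bc : NavierBC L u) :
    EqOn (derivOn L 2 u) (-dirichletInv L (fourthDeriv L u)) (Icc 0 L) := by
  have hneg : EqOn (-derivOn L 2 u) (dirichletInv L (fourthDeriv L u)) (Icc 0 L) := by
    refine eqOn_dirichletInv_of_ae_hasDerivAt hL (d := -derivOn L 3 u)
      (hu.absolutelyContinuous_derivOn hL (by norm_num)).neg
      (hu.absolutelyContinuous_derivOn hL le_rfl).neg
      ((hu.ae_hasDerivAt_derivOn hL (by norm_num)).mono fun x hx => hx.neg) ?_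
      (by simp [bc.2.2.1]) (by simp [bc.2.2.2])
    filter_upwards [hu.ae_hasDerivAt_derivOn hL le_rfl, fourthDeriv_ae_eq L u] with x hx hxu
    exact hxu ▸ hx.neg
  exact fun x hx => neg_eq_iff_eq_neg.1 (hneg hx)

lemma eqOn_dirichletInv_dirichletInv (hu : IsW41 L u) (hL : 0 < L) (bc : NavierBC L u) :
    EqOn u (dirichletInv L (dirichletInv L (fourthDeriv L u))) (Icc 0 L) := by
  have hone := hu.ae_hasDerivAt_derivOn hL (k := 0) (by norm_num)
  have huac := hu.absolutelyContinuous_derivOn hL (k := 0) (by norm_num)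
  rw [derivOn_zero] at hone huac
  refine eqOn_dirichletInv_of_ae_hasDerivAt hL huac
    (hu.absolutelyContinuous_derivOn hL (k := 1) (by norm_num)) hone ?_ bc.1 bc.2.1
  filter_upwards [hu.ae_hasDerivAt_derivOn hL (k := 1) (by norm_num),
    ae_restrict_mem measurableSet_Ioo] with x hx hxL
  rwa [hu.derivOn_two_eq hL bc (Ioo_subset_Icc_self hxL)] at hx

end IsW41

end NavierGreenOperator

/-! ### The maximum principle for the nonlocal beam operator -/

lemma sinh_le_mul_cosh {x : ℝ} (hx : 0 ≤ x) : Real.sinh x ≤ x * Real.cosh x := by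
  have hderiv (y : ℝ) : HasDerivAt (fun y => y * Real.cosh y - Real.sinh y) (y * Real.sinh y) y :=
    (((hasDerivAt_id' y).mul (Real.hasDerivAt_cosh y)).sub (Real.hasDerivAt_sinh y)).congr_deriv
      (by ring)
  have hmono : MonotoneOn (fun y => y * Real.cosh y - Real.sinh y) (Ici 0) := by
    refine monotoneOn_of_deriv_nonneg (convex_Ici 0)
      (fun y _ => (hderiv y).continuousAt.continuousWithinAt)
      (fun y _ => (hderiv y).differentiableAt.differentiableWithinAt) fun y hy => ?_
    rw [interior_Ici] at hy
    rw [(hderiv y).deriv]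
    exact mul_nonneg (le_of_lt hy) (Real.sinh_nonneg_iff.2 (le_of_lt hy))
  simpa using hmono self_mem_Ici hx hx

lemma cosh_sub_one_le {x : ℝ} (hx : 0 ≤ x) : Real.cosh x - 1 ≤ x * Real.sinh x / 2 := by
  have hhalf := sinh_le_mul_cosh (x := x / 2) (by positivity)
  have hsinh : 0 ≤ Real.sinh (x / 2) := Real.sinh_nonneg_iff.2 (by positivity)
  rw [← mul_div_cancel₀ x two_ne_zero, mul_div_assoc, Real.cosh_two_mul, Real.sinh_two_mul,
    Real.cosh_sq]
  nlinarith [mul_le_mul_of_nonneg_left hhalf hsinh]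

section Helmholtz

variable {L m : ℝ} {f g h : ℝ → ℝ}

lemma sinh_mul_pos (hL : 0 < L) (hm : 0 < m) : 0 < Real.sinh (m * L) :=
  Real.sinh_pos_iff.2 (mul_pos hm hL)

lemma hasDerivAt_sinh_mul (m x : ℝ) :
    HasDerivAt (fun s => Real.sinh (m * s)) (m * Real.cosh (m * x)) x :=
  (((hasDerivAt_id' x).const_mul m).sinh).congr_deriv (by ring)

lemma hasDerivAt_cosh_mul (m x : ℝ) :
    HasDerivAt (fun s => Real.cosh (m * s)) (m * Real.sinh (m * x)) x :=
  (((hasDerivAt_id' x).const_mul m).cosh).congr_deriv (by ring)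

lemma hasDerivAt_sinh_mul_sub (m L x : ℝ) :
    HasDerivAt (fun s => Real.sinh (m * (L - s))) (-(m * Real.cosh (m * (L - x)))) x :=
  ((((hasDerivAt_id' x).const_sub L).const_mul m).sinh).congr_deriv (by ring)

lemma hasDerivAt_cosh_mul_sub (m L x : ℝ) :
    HasDerivAt (fun s => Real.cosh (m * (L - s))) (-(m * Real.sinh (m * (L - x)))) x :=
  ((((hasDerivAt_id' x).const_sub L).const_mul m).cosh).congr_deriv (by ring)

lemma locallyIntegrable_continuous_mul (hf : Continuous f) (hg : LocallyIntegrable g) :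
    LocallyIntegrable fun s => f s * g s :=
  locallyIntegrable_iff.2 fun _ hk =>
    (hg.integrableOn_isCompact hk).continuousOn_mul hf.continuousOn hk

/-- The solution `v` of `-v'' + m² v = g`, `v 0 = v L = 0`, given by its Green function. -/
noncomputable def helmholtzInv (L m : ℝ) (g : ℝ → ℝ) (x : ℝ) : ℝ :=
  (Real.sinh (m * (L - x)) * (∫ s in (0 : ℝ)..x, Real.sinh (m * s) * g s) +
    Real.sinh (m * x) * ∫ s in x..L, Real.sinh (m * (L - s)) * g s) / (m * Real.sinh (m * L))

lemma continuous_helmholtzInv (L m : ℝ) (hg : LocallyIntegrable g) :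
    Continuous (helmholtzInv L m g) := by
  have continuous_primitive {θ : ℝ → ℝ} (hθ : Continuous θ) (c : ℝ) :
      Continuous fun x => ∫ s in c..x, θ s * g s :=
    intervalIntegral.continuous_primitive (fun _ _ =>
      intervalIntegrable_of_locallyIntegrable (locallyIntegrable_continuous_mul hθ hg)) c
  unfold helmholtzInv
  simp only [fun x => intervalIntegral.integral_symm (μ := volume)
    (f := fun s => Real.sinh (m * (L - s)) * g s) L x]
  have := continuous_primitive (θ := fun s => Real.sinh (m * s)) (by fun_prop) 0
  have := continuous_primitive (θ := fun s => Real.sinh (m * (L - s))) (by fun_prop) L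
  fun_prop

lemma helmholtzInv_nonneg (hm : 0 < m) (hg : ∀ᵐ x ∂volume.restrict (Ioo 0 L), 0 ≤ g x)
    {x : ℝ} (hx : x ∈ Icc 0 L) : 0 ≤ helmholtzInv L m g x := by
  have hsinh {y : ℝ} (hy : 0 ≤ y) : 0 ≤ Real.sinh (m * y) :=
    Real.sinh_nonneg_iff.2 (mul_nonneg hm.le hy)
  have hae : ∀ᵐ s ∂volume.restrict (Icc 0 L), s ∈ Icc 0 L ∧ 0 ≤ g s := by
    rw [← restrict_Ioo_eq_restrict_Icc]
    exact ((ae_restrict_mem measurableSet_Ioo).mono fun s hs => Ioo_subset_Icc_self hs).and hg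
  have hleft : 0 ≤ ∫ s in (0 : ℝ)..x, Real.sinh (m * s) * g s :=
    intervalIntegral.integral_nonneg_of_ae_restrict hx.1 <|
      (ae_restrict_of_ae_restrict_of_subset (Icc_subset_Icc_right hx.2) hae).mono
        fun s hs => mul_nonneg (hsinh hs.1.1) hs.2
  have hright : 0 ≤ ∫ s in x..L, Real.sinh (m * (L - s)) * g s :=
    intervalIntegral.integral_nonneg_of_ae_restrict hx.2 <|
      (ae_restrict_of_ae_restrict_of_subset (Icc_subset_Icc_left hx.1) hae).mono
        fun s hs => mul_nonneg (hsinh (sub_nonneg.2 hs.1.2)) hs.2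
  exact div_nonneg (add_nonneg (mul_nonneg (hsinh (sub_nonneg.2 hx.2)) hleft)
    (mul_nonneg (hsinh hx.1) hright)) (mul_nonneg hm.le (hsinh (hx.1.trans hx.2)))

lemma sinh_mul_eq (m L x : ℝ) : Real.sinh (m * L) =
    Real.sinh (m * (L - x)) * Real.cosh (m * x) + Real.cosh (m * (L - x)) * Real.sinh (m * x) := by
  rw [← Real.sinh_add]
  ring_nf

lemma dirichletInv_eq_helmholtzInv (hL : 0 < L) (hm : 0 < m) (hh : LocallyIntegrable h) :
    EqOn (dirichletInv L h) (helmholtzInv L m fun s => h s + m ^ 2 * dirichletInv L h s)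
      (Icc 0 L) := by
  intro x hx
  have hleft := green_formula L (θ := fun s => Real.sinh (m * s)) hh (hasDerivAt_sinh_mul m)
    (fun x => (hasDerivAt_cosh_mul m x).const_mul m) (by fun_prop) hx.1
  have hright := green_formula L (θ := fun s => Real.sinh (m * (L - s))) hh
    (hasDerivAt_sinh_mul_sub m L)
    (fun x => ((hasDerivAt_cosh_mul_sub m L x).const_mul m).neg) (by fun_prop) hx.2
  simp only [dirichletInv_zero_left, dirichletInv_zero_right hL, sub_self, mul_zero,
    Real.sinh_zero, zero_mul, sub_zero, zero_sub] at hleft hright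
  have integrand_left (s : ℝ) : Real.sinh (m * s) * (h s + m ^ 2 * dirichletInv L h s) =
      Real.sinh (m * s) * h s + m * (m * Real.sinh (m * s)) * dirichletInv L h s := by ring
  have integrand_right (s : ℝ) :
      Real.sinh (m * (L - s)) * (h s + m ^ 2 * dirichletInv L h s) = Real.sinh (m * (L - s)) * h s +
        -(m * -(m * Real.sinh (m * (L - s)))) * dirichletInv L h s := by ring
  have := sinh_mul_pos hL hm
  rw [helmholtzInv, eq_div_iff (by positivity)]
  simp only [integrand_left, integrand_right]
  rw [hleft, hright, sinh_mul_eq m L x]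
  ring

section Kernel

variable {φ φ' ψ ψ' p q : ℝ → ℝ}

lemma absolutelyContinuous_mul_primitive_add (L : ℝ) (hφ : ∀ x, HasDerivAt φ (φ' x) x)
    (hφ' : Continuous φ') (hψ : ∀ x, HasDerivAt ψ (ψ' x) x) (hψ' : Continuous ψ')
    (hp : Continuous p) (hq : Continuous q) (hg : LocallyIntegrable g) (a b : ℝ) :
    AbsolutelyContinuousOnInterval
      (fun x => φ x * (∫ s in (0 : ℝ)..x, p s * g s) + ψ x * ∫ s in x..L, q s * g s) a b := by
  have hq_ac : AbsolutelyContinuousOnInterval (fun x => ∫ s in x..L, q s * g s) a b := by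
    simp only [fun x => intervalIntegral.integral_symm (μ := volume) (f := fun s => q s * g s) L x]
    exact (absolutelyContinuousOnInterval_primitive
      (locallyIntegrable_continuous_mul hq hg) L).fun_neg
  exact ((absolutelyContinuousOnInterval_of_hasDerivAt hφ hφ').fun_mul
      (absolutelyContinuousOnInterval_primitive (locallyIntegrable_continuous_mul hp hg) 0)).fun_add
    ((absolutelyContinuousOnInterval_of_hasDerivAt hψ hψ').fun_mul hq_ac)

lemma ae_hasDerivAt_mul_primitive_add (L : ℝ) (hφ : ∀ x, HasDerivAt φ (φ' x) x)
    (hψ : ∀ x, HasDerivAt ψ (ψ' x) x) (hp : Continuous p) (hq : Continuous q)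
    (hg : LocallyIntegrable g) :
    ∀ᵐ x, HasDerivAt
      (fun x => φ x * (∫ s in (0 : ℝ)..x, p s * g s) + ψ x * ∫ s in x..L, q s * g s)
      (φ' x * (∫ s in (0 : ℝ)..x, p s * g s) + ψ' x * (∫ s in x..L, q s * g s) +
        (φ x * p x - ψ x * q x) * g x) x := by
  filter_upwards [LocallyIntegrable.ae_hasDerivAt_integral (locallyIntegrable_continuous_mul hp hg),
    LocallyIntegrable.ae_hasDerivAt_integral (locallyIntegrable_continuous_mul hq hg)] with x hP hQ
  have hQ' : HasDerivAt (fun x => ∫ s in x..L, q s * g s) (-(q x * g x)) x := by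
    simp only [fun x => intervalIntegral.integral_symm (μ := volume) (f := fun s => q s * g s) L x]
    exact (hQ L).fun_neg
  exact (((hφ x).mul (hP 0)).add ((hψ x).mul hQ')).congr_deriv (by ring)

end Kernel

lemma helmholtzInv_eq_dirichletInv (hL : 0 < L) (hm : 0 < m) (hg : LocallyIntegrable g) :
    EqOn (helmholtzInv L m g) (dirichletInv L fun s => g s - m ^ 2 * helmholtzInv L m g s)
      (Icc 0 L) := by
  have := sinh_mul_pos hL hm
  have hp : Continuous fun s => Real.sinh (m * s) := by fun_prop
  have hq : Continuous fun s => Real.sinh (m * (L - s)) := by fun_prop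
  have hcosh (x : ℝ) :
      HasDerivAt (fun s => -Real.cosh (m * (L - s))) (m * Real.sinh (m * (L - x))) x :=
    (hasDerivAt_cosh_mul_sub m L x).fun_neg.congr_deriv (neg_neg _)
  have heq : helmholtzInv L m g = fun x => (m * Real.sinh (m * L))⁻¹ *
      (Real.sinh (m * (L - x)) * (∫ s in (0 : ℝ)..x, Real.sinh (m * s) * g s) +
        Real.sinh (m * x) * ∫ s in x..L, Real.sinh (m * (L - s)) * g s) :=
    funext fun x => div_eq_inv_mul _ _
  refine eqOn_dirichletInv_of_ae_hasDerivAt hL (d := fun x => (Real.sinh (m * L))⁻¹ *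
      (-Real.cosh (m * (L - x)) * (∫ s in (0 : ℝ)..x, Real.sinh (m * s) * g s) +
        Real.cosh (m * x) * ∫ s in x..L, Real.sinh (m * (L - s)) * g s)) ?_
    ((absolutelyContinuous_mul_primitive_add L hcosh (by fun_prop) (hasDerivAt_cosh_mul m)
      (by fun_prop) hp hq hg 0 L).const_mul _)
    (ae_restrict_of_ae ?_) (ae_restrict_of_ae ?_) (by simp [heq]) (by simp [heq])
  · rw [heq]
    exact (absolutelyContinuous_mul_primitive_add L (hasDerivAt_sinh_mul_sub m L) (by fun_prop)
      (hasDerivAt_sinh_mul m) (by fun_prop) hp hq hg 0 L).const_mul _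
  · rw [heq]
    filter_upwards [ae_hasDerivAt_mul_primitive_add L (hasDerivAt_sinh_mul_sub m L)
      (hasDerivAt_sinh_mul m) hp hq hg] with x hx
    refine (hx.const_mul (m * Real.sinh (m * L))⁻¹).congr_deriv ?_
    field_simp
    ring
  · filter_upwards [ae_hasDerivAt_mul_primitive_add L hcosh (hasDerivAt_cosh_mul m) hp hq hg]
      with x hx
    refine (hx.const_mul (Real.sinh (m * L))⁻¹).congr_deriv ?_
    simp only [heq]
    field_simp
    rw [sinh_mul_eq m L x]
    ring

end Helmholtz

/-- The solution `e` of `-e'' + m² e = 1`, `e 0 = e L = 0`. -/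
noncomputable def helmholtzOne (L m x : ℝ) : ℝ :=
  (1 - (Real.sinh (m * x) + Real.sinh (m * (L - x))) / Real.sinh (m * L)) / m ^ 2

section HelmholtzOne

variable {L m x : ℝ}

lemma continuous_helmholtzOne (L m : ℝ) : Continuous (helmholtzOne L m) := by
  unfold helmholtzOne
  fun_prop

lemma helmholtzOne_symm (L m x : ℝ) : helmholtzOne L m (L - x) = helmholtzOne L m x := by
  rw [helmholtzOne, helmholtzOne, sub_sub_cancel, add_comm]

lemma helmholtzOne_nonneg (hm : 0 < m) (hx : x ∈ Icc 0 L) : 0 ≤ helmholtzOne L m x := by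
  have hleft : 0 ≤ Real.sinh (m * x) := Real.sinh_nonneg_iff.2 (mul_nonneg hm.le hx.1)
  have hright : 0 ≤ Real.sinh (m * (L - x)) :=
    Real.sinh_nonneg_iff.2 (mul_nonneg hm.le (sub_nonneg.2 hx.2))
  refine div_nonneg (sub_nonneg.2 (div_le_one_of_le₀ ?_ ?_)) (sq_nonneg m)
  · rw [sinh_mul_eq m L x, add_comm]
    exact add_le_add (le_mul_of_one_le_right hright (Real.one_le_cosh _))
      (le_mul_of_one_le_left hleft (Real.one_le_cosh _))
  · exact Real.sinh_nonneg_iff.2 (mul_nonneg hm.le (hx.1.trans hx.2))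

lemma helmholtzOne_le (hL : 0 < L) (hm : 0 < m) (x : ℝ) :
    helmholtzOne L m x ≤
      (Real.cosh (m * L) - 1) / (m ^ 2 * Real.sinh (m * L)) * Real.sinh (m * x) := by
  have := sinh_mul_pos hL hm
  have hdiff : (Real.cosh (m * L) - 1) / (m ^ 2 * Real.sinh (m * L)) * Real.sinh (m * x) -
      helmholtzOne L m x = (Real.cosh (m * x) - 1) / m ^ 2 := by
    rw [helmholtzOne, mul_sub m, Real.sinh_sub]
    field_simp
    ring
  have := div_nonneg (sub_nonneg.2 (Real.one_le_cosh (m * x))) (sq_nonneg m)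
  linarith

lemma eqOn_helmholtzOne (hL : 0 < L) (hm : 0 < m) :
    EqOn (helmholtzOne L m) (dirichletInv L fun s => 1 - m ^ 2 * helmholtzOne L m s)
      (Icc 0 L) := by
  have hsinh := sinh_mul_pos hL hm
  have hone (x : ℝ) : HasDerivAt (helmholtzOne L m)
      (-(Real.cosh (m * x) - Real.cosh (m * (L - x))) / (m * Real.sinh (m * L))) x := by
    refine ((((hasDerivAt_sinh_mul m x).add (hasDerivAt_sinh_mul_sub m L x)).div_const
      (Real.sinh (m * L))).const_sub 1 |>.div_const (m ^ 2)).congr_deriv ?_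
    field_simp
    ring
  have htwo (x : ℝ) : HasDerivAt
      (fun x => -(Real.cosh (m * x) - Real.cosh (m * (L - x))) / (m * Real.sinh (m * L)))
      (-(1 - m ^ 2 * helmholtzOne L m x)) x := by
    refine (((hasDerivAt_cosh_mul m x).fun_sub (hasDerivAt_cosh_mul_sub m L x)).fun_neg.div_const
      (m * Real.sinh (m * L))).congr_deriv ?_
    rw [helmholtzOne]
    field_simp
    ring
  have he := continuous_helmholtzOne L m
  refine eqOn_dirichletInv_of_ae_hasDerivAt hL
    (absolutelyContinuousOnInterval_of_hasDerivAt hone (by fun_prop))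
    (absolutelyContinuousOnInterval_of_hasDerivAt htwo (by fun_prop))
    (ae_of_all _ hone) (ae_of_all _ htwo) ?_ ?_ <;>
  simp [helmholtzOne, hsinh.ne']

lemma dirichletInv_one (hL : L ≠ 0) (x : ℝ) : dirichletInv L (fun _ => 1) x = x * (L - x) / 2 := by
  simp only [dirichletInv, intervalIntegral.integral_const, sub_zero, smul_eq_mul, mul_one,
    integral_id]
  field_simp
  ring

lemma dirichletInv_helmholtzOne (hL : 0 < L) (hm : 0 < m) :
    EqOn (dirichletInv L (helmholtzOne L m))
      (fun s => (s * (L - s) / 2 - helmholtzOne L m s) / m ^ 2) (Icc 0 L) := by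
  intro s hs
  have he := eqOn_helmholtzOne hL hm hs
  rw [dirichletInv_sub L (locallyIntegrable_const 1)
    ((continuous_helmholtzOne L m).const_mul (m ^ 2)).locallyIntegrable, dirichletInv_const_mul,
    dirichletInv_one hL.ne'] at he
  rw [eq_div_iff (by positivity)]
  linarith

lemma dirichletInv_helmholtzOne_symm (hL : 0 < L) (hm : 0 < m) (hx : x ∈ Icc 0 L) :
    dirichletInv L (helmholtzOne L m) (L - x) = dirichletInv L (helmholtzOne L m) x := by
  rw [dirichletInv_helmholtzOne hL hm hx, dirichletInv_helmholtzOne hL hm (by grind)]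
  simp only [helmholtzOne_symm]
  ring

lemma dirichletInv_helmholtzOne_le (hL : 0 < L) (hm : 0 < m) (hx : x ∈ Icc 0 L) :
    dirichletInv L (helmholtzOne L m) x ≤
      (L / 2 - (Real.cosh (m * L) - 1) / (m * Real.sinh (m * L))) / m ^ 3 * Real.sinh (m * x) := by
  have := sinh_mul_pos hL hm
  have hself : m * x ≤ Real.sinh (m * x) := Real.self_le_sinh_iff.2 (mul_nonneg hm.le hx.1)
  have hcosh := cosh_sub_one_le (mul_nonneg hm.le hx.1)
  have hdiff : (L / 2 - (Real.cosh (m * L) - 1) / (m * Real.sinh (m * L))) / m ^ 3 *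
        Real.sinh (m * x) - dirichletInv L (helmholtzOne L m) x =
      (m * (L - x) * (Real.sinh (m * x) - m * x) / 2 +
        (m * x * Real.sinh (m * x) / 2 - (Real.cosh (m * x) - 1))) / m ^ 4 := by
    rw [dirichletInv_helmholtzOne hL hm hx]
    simp only [helmholtzOne, mul_sub m, Real.sinh_sub]
    field_simp
    ring
  rw [← sub_nonneg, hdiff]
  exact div_nonneg (add_nonneg (div_nonneg (mul_nonneg (mul_nonneg hm.le (sub_nonneg.2 hx.2))
    (sub_nonneg.2 hself)) zero_le_two) (sub_nonneg.2 hcosh)) (by positivity)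

lemma integral_helmholtzOne (hL : 0 < L) (hm : 0 < m) :
    ∫ s in (0 : ℝ)..L, helmholtzOne L m s =
      (L - 2 * (Real.cosh (m * L) - 1) / (m * Real.sinh (m * L))) / m ^ 2 := by
  have := sinh_mul_pos hL hm
  have hprim (s : ℝ) : HasDerivAt (fun s => (s - (Real.cosh (m * s) - Real.cosh (m * (L - s))) /
      (m * Real.sinh (m * L))) / m ^ 2) (helmholtzOne L m s) s := by
    refine (((hasDerivAt_id' s).sub (((hasDerivAt_cosh_mul m s).sub
      (hasDerivAt_cosh_mul_sub m L s)).div_const (m * Real.sinh (m * L)))).div_const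
      (m ^ 2)).congr_deriv ?_
    rw [helmholtzOne]
    field_simp
    ring
  rw [intervalIntegral.integral_eq_sub_of_hasDerivAt (fun s _ => hprim s)
    ((continuous_helmholtzOne L m).intervalIntegrable _ _)]
  simp only [sub_self, sub_zero, mul_zero, Real.cosh_zero]
  ring

lemma integral_dirichletInv_helmholtzOne (hL : 0 < L) (hm : 0 < m) :
    ∫ s in (0 : ℝ)..L, dirichletInv L (helmholtzOne L m) s =
      (L ^ 3 / 12 - (L - 2 * (Real.cosh (m * L) - 1) / (m * Real.sinh (m * L))) / m ^ 2) /
        m ^ 2 := by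
  have hpoly : ∫ s in (0 : ℝ)..L, s * (L - s) / 2 = L ^ 3 / 12 := by
    have hprim (s : ℝ) : HasDerivAt (fun s => s ^ 2 * L / 4 - s ^ 3 / 6) (s * (L - s) / 2) s := by
      refine ((((hasDerivAt_pow 2 s).mul_const L).div_const 4).sub
        ((hasDerivAt_pow 3 s).div_const 6)).congr_deriv ?_
      push_cast
      ring
    rw [intervalIntegral.integral_eq_sub_of_hasDerivAt (fun s _ => hprim s)
      (Continuous.intervalIntegrable (by fun_prop) _ _)]
    ring
  rw [intervalIntegral.integral_congr (uIcc_of_le hL.le ▸ dirichletInv_helmholtzOne hL hm),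
    intervalIntegral.integral_div, intervalIntegral.integral_sub
      (Continuous.intervalIntegrable (by fun_prop) _ _)
      ((continuous_helmholtzOne L m).intervalIntegrable _ _), hpoly, integral_helmholtzOne hL hm]

end HelmholtzOne

/-- A constant `C` in the bound of the rank-one kernel `e(x) (R e)(s)` by `C` times the
Green function of `-v'' + m² v`, where `e = helmholtzOne L m` and `R = dirichletInv L`. -/
noncomputable def kernelRatio (L m : ℝ) : ℝ :=
  (L / 2 - (Real.cosh (m * L) - 1) / (m * Real.sinh (m * L))) * (Real.cosh (m * L) - 1) / m ^ 4

section MaximumPrinciple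

variable {L m N : ℝ} {g h : ℝ → ℝ}

lemma kernelRatio_sub_integral (hL : 0 < L) (hm : 0 < m) :
    kernelRatio L m - ∫ s in (0 : ℝ)..L, dirichletInv L (helmholtzOne L m) s =
      (6 * (m * L) * Real.cosh (m * L) + 6 * (m * L) - 12 * Real.sinh (m * L) - (m * L) ^ 3) /
        (12 * m ^ 5) := by
  have hsinh := sinh_mul_pos hL hm
  have hcosh_sq := Real.cosh_sq (m * L)
  rw [integral_dirichletInv_helmholtzOne hL hm, kernelRatio]
  generalize Real.sinh (m * L) = S, Real.cosh (m * L) = C at *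
  field_simp
  linear_combination -24 * hcosh_sq

lemma helmholtzInv_add_const (hL : 0 < L) (hm : 0 < m) (hg : LocallyIntegrable g) (c x : ℝ) :
    helmholtzInv L m (fun s => g s + c) x = helmholtzInv L m g x + c * helmholtzOne L m x := by
  have := sinh_mul_pos hL hm
  have integral_left : ∫ s in (0 : ℝ)..x, Real.sinh (m * s) = (Real.cosh (m * x) - 1) / m := by
    rw [intervalIntegral.integral_eq_sub_of_hasDerivAt (f := fun s => Real.cosh (m * s) / m)
      (fun s _ => ((hasDerivAt_cosh_mul m s).div_const m).congr_deriv (by field_simp))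
      (Continuous.intervalIntegrable (by fun_prop) _ _)]
    simp [sub_div]
  have integral_right :
      ∫ s in x..L, Real.sinh (m * (L - s)) = (Real.cosh (m * (L - x)) - 1) / m := by
    rw [intervalIntegral.integral_eq_sub_of_hasDerivAt
      (f := fun s => -(Real.cosh (m * (L - s)) / m))
      (fun s _ => ((hasDerivAt_cosh_mul_sub m L s).div_const m).fun_neg.congr_deriv (by field_simp))
      (Continuous.intervalIntegrable (by fun_prop) _ _)]
    simp only [sub_self, mul_zero, Real.cosh_zero]
    ring
  have integral_split {θ : ℝ → ℝ} (hθ : Continuous θ) (a b : ℝ) :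
      ∫ s in a..b, θ s * (g s + c) = (∫ s in a..b, θ s * g s) + (∫ s in a..b, θ s) * c := by
    rw [← intervalIntegral.integral_mul_const, ← intervalIntegral.integral_add
      (intervalIntegrable_of_locallyIntegrable (locallyIntegrable_continuous_mul hθ hg))
      ((hθ.mul_const c).intervalIntegrable _ _)]
    simp only [mul_add]
  rw [helmholtzInv, helmholtzInv, helmholtzOne, integral_split (by fun_prop),
    integral_split (by fun_prop), integral_left, integral_right]
  field_simp
  rw [sinh_mul_eq m L x]
  ring

lemma helmholtzOne_mul_dirichletInv_le (hL : 0 < L) (hm : 0 < m) {x s : ℝ} (hx : x ∈ Icc 0 L)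
    (hs : s ∈ Icc 0 L) : helmholtzOne L m x * dirichletInv L (helmholtzOne L m) s ≤
      kernelRatio L m / (m * Real.sinh (m * L)) * Real.sinh (m * x) * Real.sinh (m * s) := by
  have he := helmholtzOne_le hL hm x
  have he_nonneg := helmholtzOne_nonneg hm hx
  have hRe_nonneg : 0 ≤ dirichletInv L (helmholtzOne L m) s :=
    dirichletInv_nonneg (continuous_helmholtzOne L m).locallyIntegrable
      (ae_restrict_of_forall_mem measurableSet_Ioo fun y hy =>
        helmholtzOne_nonneg hm (Ioo_subset_Icc_self hy)) hs
  refine (mul_le_mul he (dirichletInv_helmholtzOne_le hL hm hs) hRe_nonneg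
    (he_nonneg.trans he)).trans_eq ?_
  have := sinh_mul_pos hL hm
  rw [kernelRatio]
  field_simp

lemma integral_mul_le_integral_mul {θ η : ℝ → ℝ} {a b : ℝ} (hθ : Continuous θ) (hη : Continuous η)
    (hg : LocallyIntegrable g) (h : ∀ᵐ x ∂volume.restrict (Ioo 0 L), 0 ≤ g x) (ha : 0 ≤ a)
    (hab : a ≤ b) (hb : b ≤ L) (hθη : ∀ s ∈ Icc a b, θ s ≤ η s) :
    ∫ s in a..b, θ s * g s ≤ ∫ s in a..b, η s * g s := by
  rw [restrict_Ioo_eq_restrict_Icc] at h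
  refine intervalIntegral.integral_mono_ae_restrict hab
    (intervalIntegrable_of_locallyIntegrable (locallyIntegrable_continuous_mul hθ hg))
    (intervalIntegrable_of_locallyIntegrable (locallyIntegrable_continuous_mul hη hg)) ?_
  filter_upwards [ae_restrict_mem measurableSet_Icc,
    ae_restrict_of_ae_restrict_of_subset (Icc_subset_Icc ha hb) h] with s hs hgs
  exact mul_le_mul_of_nonneg_right (hθη s hs) hgs

lemma helmholtzOne_mul_integral_le (hL : 0 < L) (hm : 0 < m) (hg : LocallyIntegrable g)
    (h : ∀ᵐ x ∂volume.restrict (Ioo 0 L), 0 ≤ g x) {x : ℝ} (hx : x ∈ Icc 0 L) :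
    helmholtzOne L m x * ∫ s in (0 : ℝ)..L, dirichletInv L (helmholtzOne L m) s * g s ≤
      kernelRatio L m * helmholtzInv L m g x := by
  set ψ := dirichletInv L (helmholtzOne L m)
  set C := kernelRatio L m / (m * Real.sinh (m * L))
  have hψ : Continuous ψ :=
    continuous_dirichletInv L (continuous_helmholtzOne L m).locallyIntegrable
  have hint (a b : ℝ) : IntervalIntegrable (fun s => ψ s * g s) volume a b :=
    intervalIntegrable_of_locallyIntegrable (locallyIntegrable_continuous_mul hψ hg)
  have hleft : helmholtzOne L m x * ∫ s in (0 : ℝ)..x, ψ s * g s ≤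
      C * Real.sinh (m * (L - x)) * ∫ s in (0 : ℝ)..x, Real.sinh (m * s) * g s := by
    simp only [← intervalIntegral.integral_const_mul, ← mul_assoc]
    refine integral_mul_le_integral_mul (by fun_prop) (by fun_prop) hg h le_rfl hx.1 hx.2
      fun s hs => ?_
    rw [← helmholtzOne_symm]
    exact helmholtzOne_mul_dirichletInv_le hL hm (by grind) ⟨hs.1, hs.2.trans hx.2⟩
  have hright : helmholtzOne L m x * ∫ s in x..L, ψ s * g s ≤
      C * Real.sinh (m * x) * ∫ s in x..L, Real.sinh (m * (L - s)) * g s := by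
    simp only [← intervalIntegral.integral_const_mul, ← mul_assoc]
    refine integral_mul_le_integral_mul (by fun_prop) (by fun_prop) hg h hx.1 hx.2 le_rfl
      fun s hs => ?_
    have hsymm : ψ (L - s) = ψ s := dirichletInv_helmholtzOne_symm hL hm ⟨hx.1.trans hs.1, hs.2⟩
    rw [← hsymm]
    exact helmholtzOne_mul_dirichletInv_le hL hm hx (by grind)
  rw [← intervalIntegral.integral_add_adjacent_intervals (hint 0 x) (hint x L), mul_add]
  refine (add_le_add hleft hright).trans_eq ?_
  rw [helmholtzInv]
  ring

lemma integral_dirichletInv_helmholtzOne_mul (hL : 0 < L) (hm : 0 < m)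
    (hh : LocallyIntegrable h) :
    ∫ s in (0 : ℝ)..L, dirichletInv L (helmholtzOne L m) s * (h s + m ^ 2 * dirichletInv L h s) =
      ∫ s in (0 : ℝ)..L, dirichletInv L (dirichletInv L h) s := by
  set e := helmholtzOne L m
  set v := dirichletInv L h
  have he : Continuous e := continuous_helmholtzOne L m
  have hv : Continuous v := continuous_dirichletInv L hh
  have hRe := continuous_dirichletInv L he.locallyIntegrable
  have hswap : ∫ s in (0 : ℝ)..L, dirichletInv L e s * h s = ∫ s in (0 : ℝ)..L, e s * v s :=
    integral_dirichletInv_mul hL he hh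
  calc ∫ s in (0 : ℝ)..L, dirichletInv L e s * (h s + m ^ 2 * v s)
      = (∫ s in (0 : ℝ)..L, dirichletInv L e s * h s) +
          ∫ s in (0 : ℝ)..L, m ^ 2 * dirichletInv L e s * v s := by
        rw [← intervalIntegral.integral_add
          (intervalIntegrable_of_locallyIntegrable (locallyIntegrable_continuous_mul hRe hh))
          (Continuous.intervalIntegrable (by fun_prop) _ _)]
        exact intervalIntegral.integral_congr fun s _ => by ring
    _ = ∫ s in (0 : ℝ)..L, (e s + m ^ 2 * dirichletInv L e s) * v s := by
        rw [hswap, ← intervalIntegral.integral_add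
          (Continuous.intervalIntegrable (by fun_prop) _ _)
          (Continuous.intervalIntegrable (by fun_prop) _ _)]
        simp only [add_mul]
    _ = ∫ s in (0 : ℝ)..L, dirichletInv L (fun _ => 1) s * v s := by
        refine intervalIntegral.integral_congr fun s hs => ?_
        rw [uIcc_of_le hL.le] at hs
        simp only [dirichletInv_helmholtzOne hL hm hs, dirichletInv_one hL.ne', e]
        field_simp
        ring
    _ = ∫ s in (0 : ℝ)..L, dirichletInv L v s := by
        rw [integral_dirichletInv_mul hL continuous_const hv.locallyIntegrable]
        simp only [one_mul]

lemma integral_dirichletInv_helmholtzOne_nonneg (hL : 0 ≤ L) (hm : 0 < m) :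
    0 ≤ ∫ s in (0 : ℝ)..L, dirichletInv L (helmholtzOne L m) s :=
  intervalIntegral.integral_nonneg hL fun _ hs =>
    dirichletInv_nonneg (continuous_helmholtzOne L m).locallyIntegrable
      (ae_restrict_of_forall_mem measurableSet_Ioo fun _ hy =>
        helmholtzOne_nonneg hm (Ioo_subset_Icc_self hy)) hs

lemma dirichletInv_nonneg_of_nonlocal (hL : 0 < L) (hm : 0 < m) (hN : 0 ≤ N)
    (hcond : N * (kernelRatio L m - ∫ s in (0 : ℝ)..L, dirichletInv L (helmholtzOne L m) s) ≤ 1)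
    (hh : LocallyIntegrable h)
    (hf : ∀ᵐ x ∂volume.restrict (Ioo 0 L), 0 ≤ h x + m ^ 2 * dirichletInv L h x +
      N * ∫ t in (0 : ℝ)..L, dirichletInv L (dirichletInv L h) t)
    {x : ℝ} (hx : x ∈ Icc 0 L) : 0 ≤ dirichletInv L h x := by
  have hK := integral_dirichletInv_helmholtzOne_nonneg hL.le hm
  set K := ∫ s in (0 : ℝ)..L, dirichletInv L (helmholtzOne L m) s
  set J := ∫ t in (0 : ℝ)..L, dirichletInv L (dirichletInv L h) t with hJ
  set g : ℝ → ℝ := fun s => h s + m ^ 2 * dirichletInv L h s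
  have hψ := continuous_dirichletInv L (continuous_helmholtzOne L m).locallyIntegrable
  have hg : LocallyIntegrable g :=
    hh.add ((continuous_dirichletInv L hh).const_mul (m ^ 2)).locallyIntegrable
  have hf_int : LocallyIntegrable fun s => g s + N * J := hg.add (locallyIntegrable_const _)
  have hrepr : dirichletInv L h x =
      helmholtzInv L m (fun s => g s + N * J) x - N * J * helmholtzOne L m x := by
    rw [helmholtzInv_add_const hL hm hg, dirichletInv_eq_helmholtzInv hL hm hh hx]
    ring
  have hmoment : ∫ s in (0 : ℝ)..L, dirichletInv L (helmholtzOne L m) s * (g s + N * J) =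
      (1 + N * K) * J := by
    simp only [mul_add]
    rw [intervalIntegral.integral_add (intervalIntegrable_of_locallyIntegrable
        (locallyIntegrable_continuous_mul hψ hg)) ((hψ.mul_const _).intervalIntegrable _ _),
      integral_dirichletInv_helmholtzOne_mul hL hm hh, intervalIntegral.integral_mul_const, ← hJ]
    ring
  have hkernel := helmholtzOne_mul_integral_le hL hm hf_int hf hx
  have hnonneg := helmholtzInv_nonneg hm hf hx
  rw [hmoment] at hkernel
  have hscaled : (1 + N * K) * dirichletInv L h x =
      (1 - N * (kernelRatio L m - K)) * helmholtzInv L m (fun s => g s + N * J) x +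
      N * (kernelRatio L m * helmholtzInv L m (fun s => g s + N * J) x -
        helmholtzOne L m x * ((1 + N * K) * J)) := by
    rw [hrepr]
    ring
  refine nonneg_of_mul_nonneg_right (b := dirichletInv L h x) (a := 1 + N * K) ?_ (by positivity)
  rw [hscaled]
  exact add_nonneg (mul_nonneg (sub_nonneg.2 hcond) hnonneg)
    (mul_nonneg hN (sub_nonneg.2 hkernel))

end MaximumPrinciple

/-- The operator `u ↦ u'''' - M u'' + N ∫₀ᴸ u` of the linear nonlocal beam problem. -/
noncomputable def beamOp (L M N : ℝ) (u : ℝ → ℝ) (x : ℝ) : ℝ :=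
  derivOn L 4 u x - M * derivOn L 2 u x + N * ∫ t in (0 : ℝ)..L, u t

/-- The order `u ≤ v`, `u'' ≥ v''` on `[0, L]` that defines the sectors. -/
def SectorLE (L : ℝ) (u v : ℝ → ℝ) : Prop :=
  ∀ x ∈ Icc 0 L, u x ≤ v x ∧ derivOn L 2 v x ≤ derivOn L 2 u x

/-- The smallness condition `N C ≤ 1 + N ∫ R e` under which `beamOp L M N` obeys the maximum
principle, where `C = kernelRatio L √M`, `e = helmholtzOne L √M` and `R = dirichletInv L`. -/
def MaxPrincipleCond (L M N : ℝ) : Prop :=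
  N * (kernelRatio L √M - ∫ s in (0 : ℝ)..L, dirichletInv L (helmholtzOne L √M) s) ≤ 1

section BeamOp

variable {L M N : ℝ} {u v : ℝ → ℝ}

lemma maxPrincipleCond_zero (L M : ℝ) : MaxPrincipleCond L M 0 := by
  simp [MaxPrincipleCond]

lemma maxPrincipleCond_of_le_melanSigma (hL : 0 < L) (hM : 0 < M) (hN : 0 ≤ N)
    (h : N ≤ 4 * M / L ^ 3 * melanSigma (√M * L)) : MaxPrincipleCond L M N := by
  have hm := Real.sqrt_pos.2 hM
  rw [MaxPrincipleCond, kernelRatio_sub_integral hL hm]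
  rw [melanSigma] at h
  nth_rw 1 [← Real.sq_sqrt hM.le] at h
  generalize √M = m at h hm ⊢
  generalize 6 * (m * L) * Real.cosh (m * L) + 6 * (m * L) - 12 * Real.sinh (m * L) -
    (m * L) ^ 3 = D at h ⊢
  rw [← mul_div_assoc, div_le_one (by positivity)]
  rcases le_or_gt D 0 with hD | hD
  · exact (mul_nonpos_of_nonneg_of_nonpos hN hD).trans (by positivity)
  · rw [← le_div_iff₀ hD]
    refine h.trans_eq ?_
    field_simp
    ring

lemma beamOp_sub (hL : 0 < L) (M N : ℝ) (hu : IsW41 L u) (hv : IsW41 L v) :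
    ∀ᵐ x ∂volume.restrict (Ioo 0 L),
      beamOp L M N (u - v) x = beamOp L M N u x - beamOp L M N v x := by
  filter_upwards [hu.derivOn_four_sub hv hL, ae_restrict_mem measurableSet_Ioo] with x hx hxL
  rw [beamOp, beamOp, beamOp, hx, hu.derivOn_two_sub hv hL (Ioo_subset_Icc_self hxL),
    hu.integral_sub hv hL.le]
  ring

lemma nonneg_of_beamOp_nonneg (hL : 0 < L) (hM : 0 < M) (hN : 0 ≤ N)
    (hcond : MaxPrincipleCond L M N) (hu : IsW41 L u) (bc : NavierBC L u)
    (h : ∀ᵐ x ∂volume.restrict (Ioo 0 L), 0 ≤ beamOp L M N u x) {x : ℝ} (hx : x ∈ Icc 0 L) :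
    0 ≤ u x ∧ derivOn L 2 u x ≤ 0 := by
  have hh := hu.locallyIntegrable_fourthDeriv hL
  have hintegral : ∫ t in (0 : ℝ)..L, dirichletInv L (dirichletInv L (fourthDeriv L u)) t =
      ∫ t in (0 : ℝ)..L, u t :=
    intervalIntegral.integral_congr <|
      uIcc_of_le hL.le ▸ (hu.eqOn_dirichletInv_dirichletInv hL bc).symm
  have hmoment {y : ℝ} (hy : y ∈ Icc 0 L) : 0 ≤ dirichletInv L (fourthDeriv L u) y := by
    refine dirichletInv_nonneg_of_nonlocal hL (Real.sqrt_pos.2 hM) hN hcond hh ?_ hy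
    filter_upwards [h, fourthDeriv_ae_eq L u, ae_restrict_mem measurableSet_Ioo] with s hs hsu hsL
    rw [beamOp, hu.derivOn_two_eq hL bc (Ioo_subset_Icc_self hsL), Pi.neg_apply] at hs
    rw [hsu, hintegral, Real.sq_sqrt hM.le]
    linarith
  refine ⟨?_, ?_⟩
  · rw [hu.eqOn_dirichletInv_dirichletInv hL bc hx]
    exact dirichletInv_nonneg (continuous_dirichletInv L hh).locallyIntegrable
      (ae_restrict_of_forall_mem measurableSet_Ioo fun y hy => hmoment (Ioo_subset_Icc_self hy)) hx
  · rw [hu.derivOn_two_eq hL bc hx, Pi.neg_apply]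
    exact neg_nonpos.2 (hmoment hx)

theorem sectorLE_of_beamOp_le (hL : 0 < L) (hM : 0 < M) (hN : 0 ≤ N)
    (hcond : MaxPrincipleCond L M N) (hu : IsW41 L u) (bu : NavierBC L u) (hv : IsW41 L v)
    (bv : NavierBC L v)
    (h : ∀ᵐ x ∂volume.restrict (Ioo 0 L), beamOp L M N u x ≤ beamOp L M N v x) :
    SectorLE L u v := by
  intro x hx
  have hdiff := nonneg_of_beamOp_nonneg hL hM hN hcond (hv.sub hu hL)
    (hv.navierBC_sub hu hL bv bu) (by
      filter_upwards [h, beamOp_sub hL M N hv hu] with y hy hsub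
      rw [hsub]
      exact sub_nonneg.2 hy) hx
  rw [hv.derivOn_two_sub hu hL hx, Pi.sub_apply] at hdiff
  exact ⟨sub_nonneg.1 hdiff.1, sub_nonpos.1 hdiff.2⟩

lemma exists_nonlocal_eq {m : ℝ} (hL : 0 < L) (hm : 0 < m) (hN : 0 ≤ N) {g : ℝ → ℝ}
    (hg : LocallyIntegrable g) :
    ∃ h, LocallyIntegrable h ∧ ∀ x ∈ Icc 0 L, h x + m ^ 2 * dirichletInv L h x +
      N * ∫ t in (0 : ℝ)..L, dirichletInv L (dirichletInv L h) t = g x := by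
  set w := helmholtzInv L m g
  set e := helmholtzOne L m
  have hw : Continuous w := continuous_helmholtzInv L m hg
  have he : Continuous e := continuous_helmholtzOne L m
  have hK := integral_dirichletInv_helmholtzOne_nonneg hL.le hm
  set K := ∫ t in (0 : ℝ)..L, dirichletInv L e t
  -- Integrating `R h = w - N J e`, where `J = ∫ R (R h)`, determines `J`.
  set J := (∫ t in (0 : ℝ)..L, dirichletInv L w t) / (1 + N * K) with hJ
  set h : ℝ → ℝ := fun s => (g s - m ^ 2 * w s) - N * J * (1 - m ^ 2 * e s)
  have hgw : LocallyIntegrable fun s => g s - m ^ 2 * w s :=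
    hg.sub (hw.const_mul _).locallyIntegrable
  have hRh : EqOn (dirichletInv L h) (fun s => w s - N * J * e s) (Icc 0 L) := fun x hx => by
    rw [dirichletInv_sub L hgw (Continuous.locallyIntegrable (by fun_prop)),
      dirichletInv_const_mul, ← helmholtzInv_eq_dirichletInv hL hm hg hx,
      ← eqOn_helmholtzOne hL hm hx]
  have hRRh : ∫ t in (0 : ℝ)..L, dirichletInv L (dirichletInv L h) t = J := by
    have hRw := continuous_dirichletInv L hw.locallyIntegrable
    have hRe := continuous_dirichletInv L he.locallyIntegrable
    calc ∫ t in (0 : ℝ)..L, dirichletInv L (dirichletInv L h) t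
        = ∫ t in (0 : ℝ)..L, (dirichletInv L w t - N * J * dirichletInv L e t) := by
          refine intervalIntegral.integral_congr fun x hx => ?_
          rw [uIcc_of_le hL.le] at hx
          rw [dirichletInv_congr hRh hx, dirichletInv_sub L hw.locallyIntegrable
            (he.const_mul _).locallyIntegrable, dirichletInv_const_mul]
      _ = (∫ t in (0 : ℝ)..L, dirichletInv L w t) - N * J * K := by
          rw [intervalIntegral.integral_sub (hRw.intervalIntegrable _ _)
            ((hRe.const_mul _).intervalIntegrable _ _), intervalIntegral.integral_const_mul]
      _ = J := by
          have : 1 + N * K ≠ 0 := by positivity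
          rw [hJ]
          field_simp
          ring
  refine ⟨h, hgw.sub (Continuous.locallyIntegrable (by fun_prop)), fun x hx => ?_⟩
  rw [hRRh, hRh hx]
  simp only [h]
  ring

theorem exists_beamOp_eq (hL : 0 < L) (hM : 0 < M) (hN : 0 ≤ N) {f : ℝ → ℝ}
    (hf : IntegrableOn f (Ioo 0 L)) :
    ∃ u, IsW41 L u ∧ NavierBC L u ∧ ∀ᵐ x ∂volume.restrict (Ioo 0 L), beamOp L M N u x = f x := by
  obtain ⟨h, hh, heq⟩ := exists_nonlocal_eq hL (Real.sqrt_pos.2 hM) hN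
    ((integrable_indicator_iff measurableSet_Ioo).2 hf).locallyIntegrable
  refine ⟨dirichletInv L (dirichletInv L h), isW41_dirichletInv_dirichletInv hL hh,
    navierBC_dirichletInv_dirichletInv hL hh, ?_⟩
  filter_upwards [derivOn_four_dirichletInv_dirichletInv hL hh,
    ae_restrict_mem measurableSet_Ioo] with x hx hxL
  rw [beamOp, hx, derivOn_two_dirichletInv hL (continuous_dirichletInv L hh)
    (Ioo_subset_Icc_self hxL), Pi.neg_apply, mul_neg, sub_neg_eq_add,
    ← indicator_of_mem hxL f, ← heq x (Ioo_subset_Icc_self hxL), Real.sq_sqrt hM.le]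

end BeamOp

/-! ### Limits of hinged functions -/

section Limits

variable {L : ℝ}

lemma abs_dirichletInv_le {g G : ℝ → ℝ} (hg : LocallyIntegrable g)
    (hG : IntegrableOn G (Ioo 0 L)) (h : ∀ᵐ x ∂volume.restrict (Ioo 0 L), |g x| ≤ G x)
    {x : ℝ} (hx : x ∈ Icc 0 L) : |dirichletInv L g x| ≤ 2 * L * ∫ s in Ioo 0 L, G s := by
  have hL : 0 ≤ L := hx.1.trans hx.2
  set Q := ∫ s in Ioo 0 L, G s
  have hQ : 0 ≤ Q := integral_nonneg_of_ae (h.mono fun s hs => (abs_nonneg _).trans hs)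
  have habs_int (a b : ℝ) : IntervalIntegrable (fun s => |g s|) volume a b :=
    (intervalIntegrable_of_locallyIntegrable hg).abs
  have hprimitive {t : ℝ} (ht : t ∈ Icc 0 L) : |∫ s in (0 : ℝ)..t, g s| ≤ Q :=
    calc |∫ s in (0 : ℝ)..t, g s|
        ≤ ∫ s in (0 : ℝ)..t, |g s| := intervalIntegral.abs_integral_le_integral_abs ht.1
      _ ≤ ∫ s in (0 : ℝ)..L, |g s| := intervalIntegral.integral_mono_interval le_rfl ht.1 ht.2
          (Eventually.of_forall fun _ => abs_nonneg _) (habs_int 0 L)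
      _ = ∫ s in Ioo 0 L, |g s| := by
          rw [intervalIntegral.integral_of_le hL, integral_Ioc_eq_integral_Ioo]
      _ ≤ Q := integral_mono_ae
          (((intervalIntegrable_iff_integrableOn_Ioo_of_le hL).1 (habs_int 0 L))) hG h
  have hdouble {y : ℝ} (hy : y ∈ Icc 0 L) :
      |∫ t in (0 : ℝ)..y, ∫ s in (0 : ℝ)..t, g s| ≤ Q * L :=
    calc |∫ t in (0 : ℝ)..y, ∫ s in (0 : ℝ)..t, g s|
        ≤ Q * |y - 0| := by
          rw [← Real.norm_eq_abs]
          refine intervalIntegral.norm_integral_le_of_norm_le_const fun t ht => ?_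
          rw [uIoc_of_le hy.1] at ht
          exact hprimitive ⟨ht.1.le, ht.2.trans hy.2⟩
      _ ≤ Q * L := by
          rw [sub_zero, abs_of_nonneg hy.1]
          exact mul_le_mul_of_nonneg_left hy.2 hQ
  have hratio : |x / L| ≤ 1 := by
    rw [abs_of_nonneg (div_nonneg hx.1 hL)]
    exact div_le_one_of_le₀ hx.2 hL
  rw [dirichletInv]
  have hfirst := mul_le_mul hratio (hdouble ⟨hL, le_rfl⟩) (abs_nonneg _) zero_le_one
  rw [← abs_mul] at hfirst
  linarith [abs_sub (x / L * ∫ t in (0 : ℝ)..L, ∫ s in (0 : ℝ)..t, g s)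
    (∫ t in (0 : ℝ)..x, ∫ s in (0 : ℝ)..t, g s), hdouble hx]

lemma tendstoUniformlyOn_dirichletInv {g : ℕ → ℝ → ℝ} {φ G : ℝ → ℝ}
    (hg : ∀ k, LocallyIntegrable (g k)) (hφ : LocallyIntegrable φ)
    (hG : IntegrableOn G (Ioo 0 L))
    (hbound : ∀ k, ∀ᵐ x ∂volume.restrict (Ioo 0 L), |g k x| ≤ G x)
    (hlim : ∀ᵐ x ∂volume.restrict (Ioo 0 L), Tendsto (fun k => g k x) atTop (𝓝 (φ x))) :
    TendstoUniformlyOn (fun k => dirichletInv L (g k)) (dirichletInv L φ) atTop (Icc 0 L) := by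
  have hint {f : ℝ → ℝ} (hf : LocallyIntegrable f) : IntegrableOn f (Ioo 0 L) :=
    (hf.integrableOn_isCompact isCompact_Icc).mono_set Ioo_subset_Icc_self
  have hdiff (k : ℕ) : IntegrableOn (fun s => |g k s - φ s|) (Ioo 0 L) :=
    ((hint (hg k)).sub (hint hφ)).abs
  have hL1 : Tendsto (fun k => ∫ s in Ioo 0 L, |g k s - φ s|) atTop
      (𝓝 (∫ _ in Ioo 0 L, (0 : ℝ))) := by
    refine tendsto_integral_of_dominated_convergence (fun s => G s + |φ s|)
      (fun k => (hdiff k).aestronglyMeasurable) (hG.add (hint hφ).abs)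
      (fun k => ?_) ?_
    · filter_upwards [hbound k] with s hs
      rw [Real.norm_eq_abs, abs_abs]
      exact (abs_sub _ _).trans (add_le_add_left hs _)
    · filter_upwards [hlim] with s hs
      simpa only [sub_self, abs_zero] using (hs.sub_const (φ s)).abs
  replace hL1 := hL1.const_mul (2 * L)
  rw [integral_zero, mul_zero] at hL1
  rw [Metric.tendstoUniformlyOn_iff]
  intro ε hε
  filter_upwards [hL1.eventually (gt_mem_nhds hε)] with k hk x hx
  rw [dist_comm, Real.dist_eq, ← dirichletInv_sub L (hg k) hφ]
  exact (abs_dirichletInv_le ((hg k).sub hφ) (hdiff k) (ae_of_all _ fun _ => le_rfl) hx).trans_lt hk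

lemma integrableOn_of_tendsto_of_abs_le {g : ℕ → ℝ → ℝ} {φ G : ℝ → ℝ} {s : Set ℝ}
    (hg : ∀ k, IntegrableOn (g k) s) (hG : IntegrableOn G s)
    (hbound : ∀ k, ∀ᵐ x ∂volume.restrict s, |g k x| ≤ G x)
    (hlim : ∀ᵐ x ∂volume.restrict s, Tendsto (fun k => g k x) atTop (𝓝 (φ x))) :
    IntegrableOn φ s := by
  refine hG.mono' (aestronglyMeasurable_of_tendsto_ae atTop
    (fun k => (hg k).aestronglyMeasurable) hlim) ?_
  filter_upwards [hlim, ae_all_iff.2 hbound] with x hx hGx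
  exact le_of_tendsto hx.abs (Eventually.of_forall hGx)

theorem exists_isW41_of_tendsto_derivOn_four (hL : 0 < L) {u : ℕ → ℝ → ℝ} {φ G : ℝ → ℝ}
    (hu : ∀ k, IsW41 L (u k)) (bc : ∀ k, NavierBC L (u k)) (hG : IntegrableOn G (Ioo 0 L))
    (hbound : ∀ k, ∀ᵐ x ∂volume.restrict (Ioo 0 L), |derivOn L 4 (u k) x| ≤ G x)
    (hlim : ∀ᵐ x ∂volume.restrict (Ioo 0 L),
      Tendsto (fun k => derivOn L 4 (u k) x) atTop (𝓝 (φ x))) :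
    ∃ y, IsW41 L y ∧ NavierBC L y ∧ derivOn L 4 y =ᵐ[volume.restrict (Ioo 0 L)] φ ∧
      TendstoUniformlyOn u y atTop (Icc 0 L) ∧
      TendstoUniformlyOn (fun k => derivOn L 2 (u k)) (derivOn L 2 y) atTop (Icc 0 L) := by
  set g : ℕ → ℝ → ℝ := fun k => fourthDeriv L (u k)
  set h := (Ioo 0 L).indicator φ
  have hφ : IntegrableOn φ (Ioo 0 L) := integrableOn_of_tendsto_of_abs_le
    (fun k => (hu k).integrableOn_derivOn_four hL) hG hbound hlim
  have hg (k : ℕ) : LocallyIntegrable (g k) := (hu k).locallyIntegrable_fourthDeriv hL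
  have hh : LocallyIntegrable h :=
    ((integrable_indicator_iff measurableSet_Ioo).2 hφ).locallyIntegrable
  have hgG (k : ℕ) : ∀ᵐ x ∂volume.restrict (Ioo 0 L), |g k x| ≤ G x := by
    filter_upwards [hbound k, fourthDeriv_ae_eq L (u k)] with x hx hxu
    rwa [← hxu] at hx
  have hgh : ∀ᵐ x ∂volume.restrict (Ioo 0 L), Tendsto (fun k => g k x) atTop (𝓝 (h x)) := by
    filter_upwards [hlim, ae_restrict_mem measurableSet_Ioo] with x hx hxL
    simpa only [g, h, fourthDeriv, indicator_of_mem hxL] using hx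
  have hmoment := tendstoUniformlyOn_dirichletInv hg hh hG hgG hgh
  have hdeflection : TendstoUniformlyOn (fun k => dirichletInv L (dirichletInv L (g k)))
      (dirichletInv L (dirichletInv L h)) atTop (Icc 0 L) :=
    tendstoUniformlyOn_dirichletInv (G := fun _ => 2 * L * ∫ s in Ioo 0 L, G s)
      (fun k => (continuous_dirichletInv L (hg k)).locallyIntegrable)
      (continuous_dirichletInv L hh).locallyIntegrable (integrableOn_const (by simp))
      (fun k => ae_restrict_of_forall_mem measurableSet_Ioo fun _ hx =>
        abs_dirichletInv_le (hg k) hG (hgG k) (Ioo_subset_Icc_self hx))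
      (ae_restrict_of_forall_mem measurableSet_Ioo fun _ hx =>
        hmoment.tendsto_at (Ioo_subset_Icc_self hx))
  refine ⟨dirichletInv L (dirichletInv L h), isW41_dirichletInv_dirichletInv hL hh,
    navierBC_dirichletInv_dirichletInv hL hh,
    (derivOn_four_dirichletInv_dirichletInv hL hh).trans (indicator_ae_eq_restrict
      measurableSet_Ioo), hdeflection.congr (Eventually.of_forall fun k =>
        ((hu k).eqOn_dirichletInv_dirichletInv hL (bc k)).symm), ?_⟩
  exact (hmoment.neg.congr (Eventually.of_forall fun k =>
    ((hu k).derivOn_two_eq hL (bc k)).symm)).congr_right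
      (derivOn_two_dirichletInv hL (continuous_dirichletInv L hh)).symm

end Limits

/-! ### The sector order -/

section Sector

variable {L : ℝ} {u v : ℝ → ℝ}

lemma derivOn_fun_zero (L : ℝ) (k : ℕ) (x : ℝ) : derivOn L k (fun _ => 0) x = 0 := by
  simp [derivOn]

lemma isW41_zero (hL : 0 < L) : IsW41 L fun _ => 0 := isW41_of_contDiff hL contDiff_const

lemma navierBC_zero (L : ℝ) : NavierBC L fun _ => 0 :=
  ⟨rfl, rfl, derivOn_fun_zero L 2 0, derivOn_fun_zero L 2 L⟩

namespace SectorLE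

lemma refl (L : ℝ) (u : ℝ → ℝ) : SectorLE L u u := fun _ _ => ⟨le_rfl, le_rfl⟩

lemma antisymm (huv : SectorLE L u v) (hvu : SectorLE L v u) : EqOn u v (Icc 0 L) :=
  fun x hx => le_antisymm (huv x hx).1 (hvu x hx).1

lemma integral_le (h : SectorLE L u v) (hL : 0 ≤ L) (hu : IsW41 L u) (hv : IsW41 L v) :
    ∫ t in (0 : ℝ)..L, u t ≤ ∫ t in (0 : ℝ)..L, v t :=
  intervalIntegral.integral_mono_on hL (hu.intervalIntegrable hL) (hv.intervalIntegrable hL)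
    fun x hx => (h x hx).1

lemma derivOn_two_nonpos (h : SectorLE L (fun _ => 0) u) {x : ℝ} (hx : x ∈ Icc 0 L) :
    derivOn L 2 u x ≤ 0 :=
  (h x hx).2.trans_eq (derivOn_fun_zero L 2 x)

end SectorLE

lemma IsW41.concaveOn (hu : IsW41 L u) (hL : 0 < L) (bc : NavierBC L u)
    (h : ∀ x ∈ Icc 0 L, derivOn L 2 u x ≤ 0) : ConcaveOn ℝ (Icc 0 L) u := by
  have hh := hu.locallyIntegrable_fourthDeriv hL
  refine (concaveOn_dirichletInv (continuous_dirichletInv L hh).locallyIntegrable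
    (ae_restrict_of_forall_mem measurableSet_Ioo fun x hx => ?_)).congr
      (hu.eqOn_dirichletInv_dirichletInv hL bc).symm
  have hxL := Ioo_subset_Icc_self hx
  simpa only [hu.derivOn_two_eq hL bc hxL, Pi.neg_apply, neg_nonpos] using h x hxL

end Sector

lemma eqOn_zero_of_concaveOn_of_nonneg {f : ℝ → ℝ} {a b x₀ : ℝ} (hf : ConcaveOn ℝ (Icc a b) f)
    (hf_nonneg : ∀ x ∈ Icc a b, 0 ≤ f x) (hx₀ : x₀ ∈ Ioo a b) (h : f x₀ ≤ 0) :
    EqOn f (fun _ => 0) (Icc a b) := by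
  have hab : a ≤ b := (hx₀.1.trans hx₀.2).le
  intro x hx
  refine le_antisymm (not_lt.1 fun hpos => ?_) (hf_nonneg x hx)
  have hdrop := h.trans_lt hpos
  rcases lt_trichotomy x x₀ with hlt | rfl | hgt
  · have hmem : x₀ ∈ openSegment ℝ x b := openSegment_eq_Ioo (hlt.trans hx₀.2) ▸ ⟨hlt, hx₀.2⟩
    exact (hf.lt_right_of_left_lt hx (right_mem_Icc.2 hab) hmem hdrop).not_ge
      (h.trans (hf_nonneg b (right_mem_Icc.2 hab)))
  · exact hdrop.false
  · have hmem : x₀ ∈ openSegment ℝ a x := openSegment_eq_Ioo (hx₀.1.trans hgt) ▸ ⟨hx₀.1, hgt⟩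
    exact (hf.left_lt_of_lt_right (left_mem_Icc.2 hab) hx hmem hdrop).not_ge
      (h.trans (hf_nonneg a (left_mem_Icc.2 hab)))

lemma derivOn_even_const_mul_sin {L : ℝ} (hL : 0 < L) (A c : ℝ) (k : ℕ) {x : ℝ}
    (hx : x ∈ Icc 0 L) :
    derivOn L (2 * k) (fun s => A * Real.sin (c * s)) x =
      A * (c ^ (2 * k) * ((-1) ^ k * Real.sin (c * x))) := by
  rw [derivOn_eq_iteratedDeriv hL (by fun_prop) hx,
    iteratedDeriv_const_mul A (by fun_prop), iteratedDeriv_comp_const_mul Real.contDiff_sin c,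
    Real.iteratedDeriv_even_sin]
  simp

/-! ### The Melan equation and its iteration -/

namespace Bridge

variable {B : Bridge} {p : ℝ → ℝ}

lemma flexuralRigidity_pos (B : Bridge) : 0 < B.E * B.I := mul_pos B.E_pos B.I_pos

lemma a_pos (B : Bridge) : 0 < B.a := div_pos B.H_pos B.flexuralRigidity_pos

lemma b_pos (B : Bridge) : 0 < B.b :=
  mul_pos (mul_pos (div_pos B.q_pos B.H_pos) (div_pos (mul_pos B.Ec_pos B.Ac_pos)
    B.flexuralRigidity_pos)) (one_div_pos.2 B.Lc_pos)

lemma c_eq (B : Bridge) : B.c = B.q / B.H * B.b := by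
  rw [c, b]
  ring

lemma c_pos (B : Bridge) : 0 < B.c := B.c_eq ▸ mul_pos (div_pos B.q_pos B.H_pos) B.b_pos

lemma lam_pos (B : Bridge) : 0 < B.lam := div_pos B.L_pos (by norm_num)

lemma isW41_beta (B : Bridge) : IsW41 B.L B.beta :=
  isW41_of_contDiff B.L_pos (contDiff_const.mul (Real.contDiff_sin.comp (by fun_prop)))

lemma derivOn_two_beta {x : ℝ} (hx : x ∈ Icc 0 B.L) : derivOn B.L 2 B.beta x =
    -(B.lam * (Real.pi ^ 2 / B.L ^ 2) * Real.sin (Real.pi / B.L * x)) := by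
  refine (derivOn_even_const_mul_sin B.L_pos B.lam _ 1 hx).trans ?_
  ring

lemma derivOn_four_beta {x : ℝ} (hx : x ∈ Icc 0 B.L) : derivOn B.L 4 B.beta x =
    B.lam * (Real.pi ^ 4 / B.L ^ 4) * Real.sin (Real.pi / B.L * x) := by
  refine (derivOn_even_const_mul_sin B.L_pos B.lam _ 2 hx).trans ?_
  ring

lemma navierBC_beta (B : Bridge) : NavierBC B.L B.beta := by
  have hL := B.L_pos
  refine ⟨by simp [beta], by simp [beta, hL.ne'], ?_, ?_⟩
  · simp [derivOn_two_beta (left_mem_Icc.2 hL.le)]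
  · simp [derivOn_two_beta (right_mem_Icc.2 hL.le), hL.ne']

lemma integral_beta (B : Bridge) :
    ∫ t in (0 : ℝ)..B.L, B.beta t = 2 * B.lam * (B.L / Real.pi) := by
  have hL := B.L_pos.ne'
  have hscale : Real.pi / B.L ≠ 0 := div_ne_zero Real.pi_ne_zero hL
  simp only [beta, intervalIntegral.integral_const_mul,
    intervalIntegral.integral_comp_mul_left Real.sin hscale, integral_sin, mul_zero,
    div_mul_cancel₀ _ hL, Real.cos_zero, Real.cos_pi, smul_eq_mul, inv_div]
  ring

lemma sectorLE_zero_beta (B : Bridge) : SectorLE B.L (fun _ => 0) B.beta := by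
  intro x hx
  have hL := B.L_pos
  have hlam := B.lam_pos
  have hsin : 0 ≤ Real.sin (Real.pi / B.L * x) := by
    refine Real.sin_nonneg_of_nonneg_of_le_pi (mul_nonneg (by positivity) hx.1) ?_
    rw [div_mul_eq_mul_div, div_le_iff₀ hL]
    exact mul_le_mul_of_nonneg_left hx.2 Real.pi_pos.le
  rw [derivOn_fun_zero, derivOn_two_beta hx, beta]
  exact ⟨by positivity, neg_nonpos.2 (by positivity)⟩

lemma isLowerSolution_zero (hp : ∀ᵐ x ∂volume.restrict (Ioo 0 B.L), 0 ≤ p x) :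
    B.IsLowerSolution p fun _ => 0 := by
  refine ⟨isW41_zero B.L_pos, navierBC_zero _, ?_⟩
  filter_upwards [hp] with x hx
  simpa [melanLHS, derivOn_fun_zero] using hx

lemma melanLHS_beta {x : ℝ} (hx : x ∈ Icc 0 B.L) : B.melanLHS B.beta x =
    (Real.pi ^ 4 / (100 * B.L ^ 3) * (B.E * B.I) + B.H * Real.pi ^ 2 / (100 * B.L)
        + B.q / B.H * (B.Ec * B.Ac / B.Lc) * (Real.pi * B.L / 5000))
          * Real.sin (Real.pi / B.L * x)
      + 2 * (B.q / B.H) ^ 2 * (B.Ec * B.Ac / B.Lc) * (B.L ^ 2 / (100 * Real.pi)) := by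
  rw [melanLHS, integral_beta, derivOn_two_beta hx, derivOn_four_beta hx, lam]
  have := B.L_pos.ne'
  have := B.H_pos.ne'
  have := B.Lc_pos.ne'
  generalize Real.sin (Real.pi / B.L * x) = s
  field_simp
  ring

lemma melanLHS_eq_iff {w : ℝ → ℝ} {x : ℝ} : B.melanLHS w x = p x ↔
    derivOn B.L 4 w x = p x / (B.E * B.I) + (B.a + B.b * ∫ t in (0 : ℝ)..B.L, w t) *
      derivOn B.L 2 w x - B.c * ∫ t in (0 : ℝ)..B.L, w t := by
  have := B.E_pos.ne'
  have := B.I_pos.ne'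
  have := B.H_pos.ne'
  have := B.Lc_pos.ne'
  rw [melanLHS, a, b, c]
  field_simp
  constructor <;> intro h <;> linear_combination h

/-- The coefficient of `-v''` in the iteration. -/
noncomputable def stepM (B : Bridge) : ℝ := B.a + 2 * B.b * B.lam * (B.L / Real.pi)

/-- The coefficient of `∫ v` in the iteration. -/
noncomputable def stepN (B : Bridge) : ℝ := B.c + B.b * B.lam * (Real.pi ^ 2 / B.L ^ 2)

/-- The right-hand side of the equation of the iteration. -/
noncomputable def stepRHS (B : Bridge) (p u : ℝ → ℝ) (x : ℝ) : ℝ :=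
  p x / (B.E * B.I) + B.b * derivOn B.L 2 u x * (∫ t in (0 : ℝ)..B.L, u t)
    - 2 * B.b * B.lam * (B.L / Real.pi) * derivOn B.L 2 u x
    + B.b * B.lam * (Real.pi ^ 2 / B.L ^ 2) * ∫ t in (0 : ℝ)..B.L, u t

lemma stepM_pos (B : Bridge) : 0 < B.stepM := by
  have := B.a_pos
  have := B.b_pos
  have := B.lam_pos
  have := B.L_pos
  unfold stepM
  positivity

lemma stepN_pos (B : Bridge) : 0 < B.stepN := by
  have := B.c_pos
  have := B.b_pos
  have := B.lam_pos
  have := B.L_pos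
  unfold stepN
  positivity

lemma beamOp_sub_stepRHS (p w : ℝ → ℝ) (x : ℝ) :
    beamOp B.L B.stepM B.stepN w x - B.stepRHS p w x = (B.melanLHS w x - p x) / (B.E * B.I) := by
  have := B.E_pos.ne'
  have := B.I_pos.ne'
  have := B.H_pos.ne'
  have := B.Lc_pos.ne'
  simp only [beamOp, stepRHS, melanLHS, stepM, stepN, a, b, c]
  field_simp
  ring

lemma melanLHS_le_iff {w : ℝ → ℝ} {x : ℝ} :
    B.melanLHS w x ≤ p x ↔ beamOp B.L B.stepM B.stepN w x ≤ B.stepRHS p w x := by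
  rw [← sub_nonpos (a := beamOp _ _ _ _ _), beamOp_sub_stepRHS,
    div_le_iff₀ B.flexuralRigidity_pos, zero_mul, sub_nonpos]

lemma le_melanLHS_iff {w : ℝ → ℝ} {x : ℝ} :
    p x ≤ B.melanLHS w x ↔ B.stepRHS p w x ≤ beamOp B.L B.stepM B.stepN w x := by
  rw [← sub_nonneg (b := B.stepRHS _ _ _), beamOp_sub_stepRHS,
    le_div_iff₀ B.flexuralRigidity_pos, zero_mul, sub_nonneg]

/-- The elements of the sector `[0, β]` that lie in `W^{4,1}[0, L]` and satisfy the boundary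
conditions: the set on which the iteration is monotone. -/
structure InSector (B : Bridge) (u : ℝ → ℝ) : Prop where
  isW41 : IsW41 B.L u
  navierBC : NavierBC B.L u
  zero_le : SectorLE B.L (fun _ => 0) u
  le_beta : SectorLE B.L u B.beta

lemma inSector_zero (B : Bridge) : B.InSector fun _ => 0 :=
  ⟨isW41_zero B.L_pos, navierBC_zero _, .refl _ _, B.sectorLE_zero_beta⟩

lemma inSector_beta (B : Bridge) : B.InSector B.beta :=
  ⟨B.isW41_beta, B.navierBC_beta, B.sectorLE_zero_beta, .refl _ _⟩

lemma IsSolution.inSector {u : ℝ → ℝ} (h : B.IsSolution p u)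
    (hu : u ∈ sector B.L (fun _ => 0) B.beta) : B.InSector u :=
  ⟨h.1, h.2.1, fun x hx => ⟨(hu.2 x hx).1, (hu.2 x hx).2.2.1⟩,
    fun x hx => ⟨(hu.2 x hx).2.1, (hu.2 x hx).2.2.2⟩⟩

namespace InSector

variable {u : ℝ → ℝ}

lemma mem_sector (h : B.InSector u) : u ∈ sector B.L (fun _ => 0) B.beta :=
  ⟨h.isW41.1.of_le (by norm_num), fun x hx =>
    ⟨(h.zero_le x hx).1, (h.le_beta x hx).1, (h.zero_le x hx).2, (h.le_beta x hx).2⟩⟩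

lemma le_derivOn_two (h : B.InSector u) {x : ℝ} (hx : x ∈ Icc 0 B.L) :
    -(B.lam * (Real.pi ^ 2 / B.L ^ 2)) ≤ derivOn B.L 2 u x := by
  refine le_trans ?_ (h.le_beta x hx).2
  have := B.lam_pos
  rw [derivOn_two_beta hx, neg_le_neg_iff]
  exact mul_le_of_le_one_right (by positivity) (Real.sin_le_one _)

lemma integral_nonneg (h : B.InSector u) : 0 ≤ ∫ t in (0 : ℝ)..B.L, u t :=
  intervalIntegral.integral_nonneg B.L_pos.le fun x hx => (h.zero_le x hx).1

lemma integral_le (h : B.InSector u) :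
    ∫ t in (0 : ℝ)..B.L, u t ≤ 2 * B.lam * (B.L / Real.pi) :=
  (h.le_beta.integral_le B.L_pos.le h.isW41 B.isW41_beta).trans_eq B.integral_beta

lemma of_tendsto {u : ℕ → ℝ → ℝ} {y : ℝ → ℝ} (hu : ∀ k, B.InSector (u k)) (hy : IsW41 B.L y)
    (bc : NavierBC B.L y) (h₀ : ∀ x ∈ Icc 0 B.L, Tendsto (fun k => u k x) atTop (𝓝 (y x)))
    (h₂ : ∀ x ∈ Icc 0 B.L,
      Tendsto (fun k => derivOn B.L 2 (u k) x) atTop (𝓝 (derivOn B.L 2 y x))) :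
    B.InSector y where
  isW41 := hy
  navierBC := bc
  zero_le x hx := ⟨ge_of_tendsto' (h₀ x hx) fun k => ((hu k).zero_le x hx).1,
    le_of_tendsto' (h₂ x hx) fun k => ((hu k).zero_le x hx).2⟩
  le_beta x hx := ⟨le_of_tendsto' (h₀ x hx) fun k => ((hu k).le_beta x hx).1,
    ge_of_tendsto' (h₂ x hx) fun k => ((hu k).le_beta x hx).2⟩

end InSector

section Step

variable {u v u₁ u₂ v₁ v₂ : ℝ → ℝ}

lemma stepRHS_congr (h : EqOn u₁ u₂ (Icc 0 B.L)) {x : ℝ} (hx : x ∈ Icc 0 B.L) :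
    B.stepRHS p u₁ x = B.stepRHS p u₂ x := by
  rw [stepRHS, stepRHS, derivOn_congr h 2 hx,
    intervalIntegral.integral_congr (uIcc_of_le B.L_pos.le ▸ h)]

lemma stepRHS_mono (h₁ : B.InSector u₁) (h₂ : B.InSector u₂) (h : SectorLE B.L u₁ u₂) {x : ℝ}
    (hx : x ∈ Icc 0 B.L) : B.stepRHS p u₁ x ≤ B.stepRHS p u₂ x := by
  have hI := h.integral_le B.L_pos.le h₁.isW41 h₂.isW41
  have hd := (h x hx).2
  have hI₂ := h₂.integral_le
  have hd₁ := h₁.le_derivOn_two hx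
  simp only [stepRHS]
  generalize (∫ t in (0 : ℝ)..B.L, u₁ t) = I₁, (∫ t in (0 : ℝ)..B.L, u₂ t) = I₂ at *
  generalize derivOn B.L 2 u₁ x = d₁, derivOn B.L 2 u₂ x = d₂ at *
  have hfactor : 0 ≤ B.b * ((d₁ - d₂) * (2 * B.lam * (B.L / Real.pi) - I₂) +
      (d₁ + B.lam * (Real.pi ^ 2 / B.L ^ 2)) * (I₂ - I₁)) :=
    mul_nonneg B.b_pos.le <| add_nonneg (mul_nonneg (by linarith) (by linarith))
      (mul_nonneg (by linarith) (by linarith))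
  linarith

lemma stepRHS_zero (p : ℝ → ℝ) (x : ℝ) : B.stepRHS p (fun _ => 0) x = p x / (B.E * B.I) := by
  simp [stepRHS, derivOn_fun_zero]

lemma stepRHS_beta (p : ℝ → ℝ) (x : ℝ) : B.stepRHS p B.beta x = p x / (B.E * B.I) +
    B.b * B.lam * (Real.pi ^ 2 / B.L ^ 2) * (2 * B.lam * (B.L / Real.pi)) := by
  rw [stepRHS, integral_beta]
  ring

lemma integrableOn_stepRHS (hp : IntegrableOn p (Icc 0 B.L)) (hu : IsW41 B.L u) :
    IntegrableOn (B.stepRHS p u) (Ioo 0 B.L) := by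
  have hu₂ : IntegrableOn (derivOn B.L 2 u) (Icc 0 B.L) :=
    (hu.continuousOn_derivOn B.L_pos (by norm_num)).integrableOn_compact isCompact_Icc
  refine IntegrableOn.mono_set ?_ Ioo_subset_Icc_self
  exact (((hp.div_const _).add ((hu₂.const_mul _).mul_const _)).sub (hu₂.const_mul _)).add
    (integrable_const _)

lemma exists_isStep (hp : IntegrableOn p (Icc 0 B.L)) (hu : IsW41 B.L u) :
    ∃ v, B.IsStep p u v :=
  exists_beamOp_eq B.L_pos B.stepM_pos B.stepN_pos.le (integrableOn_stepRHS hp hu)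

namespace IsStep

lemma beamOp_ae_eq (h : B.IsStep p u v) :
    beamOp B.L B.stepM B.stepN v =ᵐ[volume.restrict (Ioo 0 B.L)] B.stepRHS p u := h.2.2

lemma sectorLE_of_stepRHS_le (hc : MaxPrincipleCond B.L B.stepM B.stepN)
    (h₁ : B.IsStep p u₁ v₁) (h₂ : B.IsStep p u₂ v₂)
    (h : ∀ x ∈ Icc 0 B.L, B.stepRHS p u₁ x ≤ B.stepRHS p u₂ x) : SectorLE B.L v₁ v₂ := by
  refine sectorLE_of_beamOp_le B.L_pos B.stepM_pos B.stepN_pos.le hc h₁.1 h₁.2.1 h₂.1 h₂.2.1 ?_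
  filter_upwards [h₁.beamOp_ae_eq, h₂.beamOp_ae_eq, ae_restrict_mem measurableSet_Ioo]
    with x e₁ e₂ hx
  exact e₁ ▸ e₂ ▸ h x (Ioo_subset_Icc_self hx)

lemma eqOn (hc : MaxPrincipleCond B.L B.stepM B.stepN) (h₁ : B.IsStep p u₁ v₁)
    (h₂ : B.IsStep p u₂ v₂) (hu : EqOn u₁ u₂ (Icc 0 B.L)) : EqOn v₁ v₂ (Icc 0 B.L) :=
  (sectorLE_of_stepRHS_le hc h₁ h₂ fun _ hx => (stepRHS_congr hu hx).le).antisymm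
    (sectorLE_of_stepRHS_le hc h₂ h₁ fun _ hx => (stepRHS_congr hu hx).ge)

lemma inSector (hc : MaxPrincipleCond B.L B.stepM B.stepN)
    (hl : B.IsLowerSolution p fun _ => 0) (hb : B.IsUpperSolution p B.beta)
    (hu : B.InSector u) (h : B.IsStep p u v) : B.InSector v where
  isW41 := h.1
  navierBC := h.2.1
  zero_le := by
    refine sectorLE_of_beamOp_le B.L_pos B.stepM_pos B.stepN_pos.le hc hl.1 hl.2.1 h.1 h.2.1 ?_
    filter_upwards [hl.2.2, h.beamOp_ae_eq, ae_restrict_mem measurableSet_Ioo] with x hlx e hx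
    exact e ▸ (melanLHS_le_iff.1 hlx).trans
      (stepRHS_mono B.inSector_zero hu hu.zero_le (Ioo_subset_Icc_self hx))
  le_beta := by
    refine sectorLE_of_beamOp_le B.L_pos B.stepM_pos B.stepN_pos.le hc h.1 h.2.1 hb.1 hb.2.1 ?_
    filter_upwards [hb.2.2, h.beamOp_ae_eq, ae_restrict_mem measurableSet_Ioo] with x hbx e hx
    exact e ▸ (stepRHS_mono hu B.inSector_beta hu.le_beta (Ioo_subset_Icc_self hx)).trans
      (le_melanLHS_iff.1 hbx)

end IsStep

lemma exists_abs_derivOn_four_le (B : Bridge) : ∃ K, ∀ p u v, B.InSector u → B.InSector v →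
    B.IsStep p u v →
      ∀ᵐ x ∂volume.restrict (Ioo 0 B.L), |derivOn B.L 4 v x| ≤ |p x / (B.E * B.I)| + K := by
  set C := B.lam * (Real.pi ^ 2 / B.L ^ 2)
  set J := 2 * B.lam * (B.L / Real.pi) with hJ
  refine ⟨B.b * B.lam * (Real.pi ^ 2 / B.L ^ 2) * J + B.stepM * C + B.stepN * J,
    fun p u v hu hv h => ?_⟩
  filter_upwards [h.beamOp_ae_eq, ae_restrict_mem measurableSet_Ioo] with x e hx
  have hxL := Ioo_subset_Icc_self hx
  have hlower := stepRHS_mono (p := p) B.inSector_zero hu hu.zero_le hxL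
  have hupper := stepRHS_mono (p := p) hu B.inSector_beta hu.le_beta hxL
  rw [stepRHS_zero] at hlower
  rw [stepRHS_beta, ← hJ] at hupper
  have hM₀ := mul_nonpos_of_nonneg_of_nonpos B.stepM_pos.le (hv.zero_le.derivOn_two_nonpos hxL)
  have hM₁ := mul_le_mul_of_nonneg_left (hv.le_derivOn_two hxL) B.stepM_pos.le
  have hN₀ := mul_nonneg B.stepN_pos.le hv.integral_nonneg
  have hN₁ := mul_le_mul_of_nonneg_left hv.integral_le B.stepN_pos.le
  rw [beamOp] at e
  have hp₀ := neg_abs_le (p x / (B.E * B.I))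
  have hp₁ := le_abs_self (p x / (B.E * B.I))
  rw [abs_le]
  constructor <;> linarith

end Step

section Iteration

lemma exists_isTheIteration (hc : MaxPrincipleCond B.L B.stepM B.stepN)
    (hp : IntegrableOn p (Icc 0 B.L)) {y₀ : ℝ → ℝ} (hy : IsW41 B.L y₀) :
    ∃ y : ℕ → ℝ → ℝ, y 0 = y₀ ∧ B.IsTheIteration p y₀ y := by
  choose S hS using fun u : {u // IsW41 B.L u} => exists_isStep hp u.2
  let next : {u // IsW41 B.L u} → {u // IsW41 B.L u} := fun u => ⟨S u, (hS u).1⟩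
  have hstep (k : ℕ) : B.IsStep p (next^[k] ⟨y₀, hy⟩) (next^[k + 1] ⟨y₀, hy⟩) := by
    rw [Function.iterate_succ_apply']
    exact hS _
  refine ⟨fun k => next^[k] ⟨y₀, hy⟩, rfl, ⟨fun _ _ => rfl, hstep⟩, fun z hz k => ?_⟩
  induction k with
  | zero => exact hz.1
  | succ k ih => exact (hz.2 k).eqOn hc (hstep k) ih

variable {u v : ℕ → ℝ → ℝ}

lemma inSector_of_isStep (hc : MaxPrincipleCond B.L B.stepM B.stepN)
    (hl : B.IsLowerSolution p fun _ => 0) (hb : B.IsUpperSolution p B.beta)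
    (hu : ∀ k, B.IsStep p (u k) (u (k + 1))) (h₀ : B.InSector (u 0)) (k : ℕ) :
    B.InSector (u k) := by
  induction k with
  | zero => exact h₀
  | succ k ih => exact (hu k).inSector hc hl hb ih

lemma sectorLE_of_isStep (hc : MaxPrincipleCond B.L B.stepM B.stepN)
    (hu : ∀ k, B.IsStep p (u k) (u (k + 1))) (iu : ∀ k, B.InSector (u k))
    (hv : ∀ k, B.IsStep p (v k) (v (k + 1))) (iv : ∀ k, B.InSector (v k))
    (h₀ : SectorLE B.L (u 0) (v 0)) (k : ℕ) : SectorLE B.L (u k) (v k) := by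
  induction k with
  | zero => exact h₀
  | succ k ih =>
    exact (hu k).sectorLE_of_stepRHS_le hc (hv k) fun _ hx => stepRHS_mono (iu k) (iv k) ih hx

lemma ae_tendsto_derivOn_four (hs : ∀ k, B.IsStep p (u k) (u (k + 1))) {V : ℝ → ℝ} {J : ℝ}
    (hV : ∀ x ∈ Icc 0 B.L, Tendsto (fun k => derivOn B.L 2 (u k) x) atTop (𝓝 (V x)))
    (hJ : Tendsto (fun k => ∫ t in (0 : ℝ)..B.L, u k t) atTop (𝓝 J)) :
    ∀ᵐ x ∂volume.restrict (Ioo 0 B.L), Tendsto (fun k => derivOn B.L 4 (u (k + 1)) x) atTop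
      (𝓝 (p x / (B.E * B.I) + (B.a + B.b * J) * V x - B.c * J)) := by
  filter_upwards [ae_all_iff.2 fun k => (hs k).beamOp_ae_eq,
    ae_restrict_mem measurableSet_Ioo] with x e hx
  have hVx := hV x (Ioo_subset_Icc_self hx)
  have hV₁ := ((tendsto_add_atTop_iff_nat 1).2 hVx).const_mul B.stepM
  have hJ₁ := ((tendsto_add_atTop_iff_nat 1).2 hJ).const_mul B.stepN
  have hRHS : Tendsto (fun k => B.stepRHS p (u k) x) atTop
      (𝓝 (p x / (B.E * B.I) + B.b * V x * J - 2 * B.b * B.lam * (B.L / Real.pi) * V x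
        + B.b * B.lam * (Real.pi ^ 2 / B.L ^ 2) * J)) :=
    ((tendsto_const_nhds.add ((hVx.const_mul B.b).mul hJ)).sub (hVx.const_mul _)).add
      (hJ.const_mul _)
  convert (hRHS.add hV₁).sub hJ₁ using 1
  · ext k
    rw [← e k, beamOp]
    ring
  · rw [stepM, stepN]
    ring_nf

lemma exists_isSolution_of_tendsto (hp : IntegrableOn p (Icc 0 B.L))
    (hs : ∀ k, B.IsStep p (u k) (u (k + 1))) (hu : ∀ k, B.InSector (u k)) {V : ℝ → ℝ} {J : ℝ}
    (hV : ∀ x ∈ Icc 0 B.L, Tendsto (fun k => derivOn B.L 2 (u k) x) atTop (𝓝 (V x)))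
    (hJ : Tendsto (fun k => ∫ t in (0 : ℝ)..B.L, u k t) atTop (𝓝 J)) :
    ∃ y, B.IsSolution p y ∧ B.InSector y ∧ TendstoUniformlyOn u y atTop (Icc 0 B.L) := by
  have hL := B.L_pos.le
  obtain ⟨K, hK⟩ := B.exists_abs_derivOn_four_le
  have hpK : IntegrableOn (fun x => |p x / (B.E * B.I)| + K) (Ioo 0 B.L) :=
    ((hp.mono_set Ioo_subset_Icc_self).div_const _).abs.add (integrable_const _)
  obtain ⟨y, hy, bc, hy₄, hlim, hlim₂⟩ := exists_isW41_of_tendsto_derivOn_four B.L_pos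
    (fun k => (hu (k + 1)).isW41) (fun k => (hu (k + 1)).navierBC) hpK
    (fun k => hK p _ _ (hu k) (hu (k + 1)) (hs k)) (ae_tendsto_derivOn_four hs hV hJ)
  have hy₂ : EqOn (derivOn B.L 2 y) V (Icc 0 B.L) := fun x hx =>
    tendsto_nhds_unique (hlim₂.tendsto_at hx) ((tendsto_add_atTop_iff_nat 1).2 (hV x hx))
  have hyJ : ∫ t in (0 : ℝ)..B.L, y t = J := by
    refine tendsto_nhds_unique (TendstoUniformlyOn.tendsto_intervalIntegral_of_continuousOn
      (Eventually.of_forall fun k => ?_) ?_) ((tendsto_add_atTop_iff_nat 1).2 hJ)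
    · exact uIcc_of_le hL ▸ (hu (k + 1)).isW41.continuousOn
    · exact uIcc_of_le hL ▸ hlim
  refine ⟨y, ⟨hy, bc, ?_⟩, .of_tendsto (fun k => hu (k + 1)) hy bc
    (fun x hx => hlim.tendsto_at hx) (fun x hx => hlim₂.tendsto_at hx), ?_⟩
  · filter_upwards [hy₄, ae_restrict_mem measurableSet_Ioo] with x hx hxL
    rw [melanLHS_eq_iff, hx, hyJ, hy₂ (Ioo_subset_Icc_self hxL)]
  · rw [← map_add_atTop_eq_nat 1]
    exact fun s hs => eventually_map.2 (hlim s hs)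

lemma exists_isSolution_of_monotone (hp : IntegrableOn p (Icc 0 B.L))
    (hs : ∀ k, B.IsStep p (u k) (u (k + 1))) (hu : ∀ k, B.InSector (u k))
    (hmono : ∀ k, SectorLE B.L (u k) (u (k + 1))) :
    ∃ y, B.IsSolution p y ∧ B.InSector y ∧ TendstoUniformlyOn u y atTop (Icc 0 B.L) :=
  exists_isSolution_of_tendsto hp hs hu
    (fun x hx => tendsto_atTop_ciInf (antitone_nat_of_succ_le fun k => (hmono k x hx).2)
      ⟨_, forall_mem_range.2 fun k => (hu k).le_derivOn_two hx⟩)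
    (tendsto_atTop_ciSup (monotone_nat_of_le_succ fun k =>
      (hmono k).integral_le B.L_pos.le (hu k).isW41 (hu (k + 1)).isW41)
      ⟨_, forall_mem_range.2 fun k => (hu k).integral_le⟩)

lemma exists_isSolution_of_antitone (hp : IntegrableOn p (Icc 0 B.L))
    (hs : ∀ k, B.IsStep p (u k) (u (k + 1))) (hu : ∀ k, B.InSector (u k))
    (hanti : ∀ k, SectorLE B.L (u (k + 1)) (u k)) :
    ∃ y, B.IsSolution p y ∧ B.InSector y ∧ TendstoUniformlyOn u y atTop (Icc 0 B.L) :=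
  exists_isSolution_of_tendsto hp hs hu
    (fun x hx => tendsto_atTop_ciSup (monotone_nat_of_le_succ fun k => (hanti k x hx).2)
      ⟨_, forall_mem_range.2 fun k => (hu k).zero_le.derivOn_two_nonpos hx⟩)
    (tendsto_atTop_ciInf (antitone_nat_of_succ_le fun k =>
      (hanti k).integral_le B.L_pos.le (hu (k + 1)).isW41 (hu k).isW41)
      ⟨_, forall_mem_range.2 fun k => (hu k).integral_nonneg⟩)

end Iteration

namespace IsSolution

variable {y y₁ y₂ : ℝ → ℝ}

lemma sectorLE_of_integral_le (h₁ : B.IsSolution p y₁) (h₂ : B.IsSolution p y₂)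
    (hy₁ : SectorLE B.L (fun _ => 0) y₁) (hy₂ : SectorLE B.L (fun _ => 0) y₂)
    (hI : ∫ t in (0 : ℝ)..B.L, y₁ t ≤ ∫ t in (0 : ℝ)..B.L, y₂ t) : SectorLE B.L y₂ y₁ := by
  have hI₂ : 0 ≤ ∫ t in (0 : ℝ)..B.L, y₂ t :=
    intervalIntegral.integral_nonneg B.L_pos.le fun x hx => (hy₂ x hx).1
  have hM : 0 < B.a + B.b * ∫ t in (0 : ℝ)..B.L, y₂ t :=
    add_pos_of_pos_of_nonneg B.a_pos (mul_nonneg B.b_pos.le hI₂)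
  refine sectorLE_of_beamOp_le B.L_pos hM le_rfl (maxPrincipleCond_zero _ _)
    h₂.1 h₂.2.1 h₁.1 h₁.2.1 ?_
  filter_upwards [h₁.2.2, h₂.2.2, ae_restrict_mem measurableSet_Ioo] with x e₁ e₂ hx
  have hy₁₂ := hy₁.derivOn_two_nonpos (Ioo_subset_Icc_self hx)
  rw [beamOp, beamOp, melanLHS_eq_iff.1 e₁, melanLHS_eq_iff.1 e₂]
  linarith [mul_nonneg_of_nonpos_of_nonpos (mul_nonpos_of_nonneg_of_nonpos B.b_pos.le hy₁₂)
    (sub_nonpos.2 hI), mul_le_mul_of_nonneg_left hI B.c_pos.le]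

lemma eqOn (h₁ : B.IsSolution p y₁) (h₂ : B.IsSolution p y₂)
    (hy₁ : SectorLE B.L (fun _ => 0) y₁) (hy₂ : SectorLE B.L (fun _ => 0) y₂) :
    EqOn y₁ y₂ (Icc 0 B.L) := by
  wlog hI : ∫ t in (0 : ℝ)..B.L, y₁ t ≤ ∫ t in (0 : ℝ)..B.L, y₂ t generalizing y₁ y₂
  · exact (this h₂ h₁ hy₂ hy₁ (le_of_not_ge hI)).symm
  have hle := h₁.sectorLE_of_integral_le h₂ hy₁ hy₂ hI
  exact (h₂.sectorLE_of_integral_le h₁ hy₂ hy₁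
    (hle.integral_le B.L_pos.le h₂.1 h₁.1)).antisymm hle

lemma pos (h : B.IsSolution p y) (hy : SectorLE B.L (fun _ => 0) y)
    (hp : ¬ ∀ᵐ x ∂volume.restrict (Ioo 0 B.L), p x = 0) {x : ℝ} (hx : x ∈ Ioo 0 B.L) :
    0 < y x := by
  by_contra! hyx
  have hzero : EqOn y (fun _ => 0) (Icc 0 B.L) := eqOn_zero_of_concaveOn_of_nonneg
    (h.1.concaveOn B.L_pos h.2.1 fun _ => hy.derivOn_two_nonpos) (fun t ht => (hy t ht).1) hx hyx
  refine hp ?_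
  filter_upwards [h.2.2, ae_restrict_mem measurableSet_Ioo] with t ht htL
  have htL' := Ioo_subset_Icc_self htL
  rw [← ht, melanLHS, derivOn_congr hzero 4 htL', derivOn_congr hzero 2 htL',
    intervalIntegral.integral_congr (uIcc_of_le B.L_pos.le ▸ hzero)]
  simp [derivOn_fun_zero]

end IsSolution

section SagSpan

variable {n : ℝ}

lemma sagSpan_pos (hn : B.q / B.H = 8 * n / B.L) : 0 < n := by
  have := div_pos B.q_pos B.H_pos
  rw [hn, div_pos_iff_of_pos_right B.L_pos] at this
  linarith

lemma stepM_eq (hn : B.q / B.H = 8 * n / B.L) :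
    B.a + B.c * B.L ^ 3 / (400 * n * Real.pi) = B.stepM := by
  have := (sagSpan_pos hn).ne'
  have := B.L_pos.ne'
  have := Real.pi_ne_zero
  rw [stepM, c_eq, hn, lam]
  field_simp
  ring

lemma stepN_eq (hn : B.q / B.H = 8 * n / B.L) :
    B.c * (1 + Real.pi ^ 2 / (800 * n)) = B.stepN := by
  have := (sagSpan_pos hn).ne'
  have := B.L_pos.ne'
  rw [stepN, c_eq, hn, lam]
  field_simp
  ring

end SagSpan

end Bridge

theorem theorem6p1_general (B : Bridge) (n : ℝ) (hn : B.q / B.H = 8 * n / B.L)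
    (p : ℝ → ℝ) (hp_int : IntegrableOn p (Icc 0 B.L))
    (hp_nonneg : ∀ᵐ x ∂volume.restrict (Ioo 0 B.L), 0 ≤ p x)
    (hp_le : ∀ᵐ x ∂volume.restrict (Ioo 0 B.L),
      p x ≤ (Real.pi ^ 4 / (100 * B.L ^ 3) * (B.E * B.I) + B.H * Real.pi ^ 2 / (100 * B.L)
            + B.q / B.H * (B.Ec * B.Ac / B.Lc) * (Real.pi * B.L / 5000))
              * Real.sin (Real.pi / B.L * x)
          + 2 * (B.q / B.H) ^ 2 * (B.Ec * B.Ac / B.Lc) * (B.L ^ 2 / (100 * Real.pi))) :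
    B.IsLowerSolution p (fun _ => 0) ∧ B.IsUpperSolution p B.beta ∧
    ∀ M N : ℝ, M = B.a + B.c * B.L ^ 3 / (400 * n * Real.pi) →
      N = B.c * (1 + Real.pi ^ 2 / (800 * n)) →
      N ≤ 4 * M / B.L ^ 3 * melanSigma (√M * B.L) →
      ∃ (y : ℝ → ℝ) (α β : ℕ → ℝ → ℝ),
        (B.IsSolution p y ∧ y ∈ sector B.L (fun _ => 0) B.beta ∧
          (¬ (∀ᵐ x ∂volume.restrict (Ioo 0 B.L), p x = 0) → ∀ x ∈ Ioo 0 B.L, 0 < y x) ∧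
          ∀ z, B.IsSolution p z → z ∈ sector B.L (fun _ => 0) B.beta →
            EqOn z y (Icc 0 B.L)) ∧
        B.IsTheIteration p (fun _ => 0) α ∧ B.IsTheIteration p B.beta β ∧
        (∀ k, ∀ x ∈ Icc 0 B.L,
          (α k x ≤ α (k + 1) x ∧ α k x ≤ β k x ∧ β (k + 1) x ≤ β k x) ∧
          (derivOn B.L 2 (α (k + 1)) x ≤ derivOn B.L 2 (α k) x ∧
            derivOn B.L 2 (β k) x ≤ derivOn B.L 2 (α k) x ∧
            derivOn B.L 2 (β k) x ≤ derivOn B.L 2 (β (k + 1)) x)) ∧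
        TendstoUniformlyOn α y atTop (Icc 0 B.L) ∧
        TendstoUniformlyOn β y atTop (Icc 0 B.L) := by
  have hl := Bridge.isLowerSolution_zero hp_nonneg
  have hb : B.IsUpperSolution p B.beta := by
    refine ⟨B.isW41_beta, B.navierBC_beta, ?_⟩
    filter_upwards [hp_le, ae_restrict_mem measurableSet_Ioo] with x hx hxL
    rwa [Bridge.melanLHS_beta (Ioo_subset_Icc_self hxL)]
  refine ⟨hl, hb, ?_⟩
  rintro _ _ rfl rfl hle
  rw [Bridge.stepM_eq hn, Bridge.stepN_eq hn] at hle
  have hc := maxPrincipleCond_of_le_melanSigma B.L_pos B.stepM_pos B.stepN_pos.le hle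
  obtain ⟨α, hα₀, hα⟩ := Bridge.exists_isTheIteration hc hp_int (isW41_zero B.L_pos)
  obtain ⟨β, hβ₀, hβ⟩ := Bridge.exists_isTheIteration hc hp_int B.isW41_beta
  have sα := hα.1.2
  have sβ := hβ.1.2
  have iα := Bridge.inSector_of_isStep hc hl hb sα (hα₀ ▸ B.inSector_zero)
  have iβ := Bridge.inSector_of_isStep hc hl hb sβ (hβ₀ ▸ B.inSector_beta)
  have hmono := Bridge.sectorLE_of_isStep hc sα iα (fun k => sα (k + 1)) (fun k => iα (k + 1))
    (hα₀ ▸ (iα 1).zero_le)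
  have hanti := Bridge.sectorLE_of_isStep hc (fun k => sβ (k + 1)) (fun k => iβ (k + 1)) sβ iβ
    (hβ₀ ▸ (iβ 1).le_beta)
  have hle := Bridge.sectorLE_of_isStep hc sα iα sβ iβ (hα₀ ▸ hβ₀ ▸ B.sectorLE_zero_beta)
  obtain ⟨y, hy, iy, hαy⟩ := Bridge.exists_isSolution_of_monotone hp_int sα iα hmono
  obtain ⟨z, hz, iz, hβz⟩ := Bridge.exists_isSolution_of_antitone hp_int sβ iβ hanti
  exact ⟨y, α, β, ⟨hy, iy.mem_sector, fun hp _ => hy.pos iy.zero_le hp,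
      fun w hw hws => hw.eqOn hy (hw.inSector hws).zero_le iy.zero_le⟩,
    hα, hβ, fun k x hx => ⟨⟨(hmono k x hx).1, (hle k x hx).1, (hanti k x hx).1⟩,
      (hmono k x hx).2, (hle k x hx).2, (hanti k x hx).2⟩,
    hαy, hβz.congr_right (hz.eqOn hy iz.zero_le iy.zero_le)⟩

theorem theorem6p1 (B : Bridge) (n : ℝ) (hn : B.q / B.H = 8 * n / B.L)
    (p : ℝ → ℝ) (hp_int : MeasureTheory.IntegrableOn p (Set.Icc 0 B.L))
    (hp_nonneg : ∀ᵐ x ∂(MeasureTheory.volume.restrict (Set.Ioo 0 B.L)), 0 ≤ p x)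
    (hp_le : ∀ᵐ x ∂(MeasureTheory.volume.restrict (Set.Ioo 0 B.L)),
      p x ≤ (Real.pi ^ 4 / (100 * B.L ^ 3) * (B.E * B.I) + B.H * Real.pi ^ 2 / (100 * B.L)
            + B.q / B.H * (B.Ec * B.Ac / B.Lc) * (Real.pi * B.L / 5000))
              * Real.sin (Real.pi / B.L * x)
          + 2 * (B.q / B.H) ^ 2 * (B.Ec * B.Ac / B.Lc) * (B.L ^ 2 / (100 * Real.pi))) :
    B.IsLowerSolution p (fun _ => 0) ∧ B.IsUpperSolution p B.beta ∧
    ∀ M N : ℝ, M = B.a + B.c * B.L ^ 3 / (400 * n * Real.pi) →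
      N = B.c * (1 + Real.pi ^ 2 / (800 * n)) →
      1 / 15.32 ≤ n →
      N ≤ 4 * M / B.L ^ 3 * melanSigma (Real.sqrt M * B.L) →
      ¬ (∀ᵐ x ∂(MeasureTheory.volume.restrict (Set.Ioo 0 B.L)), p x = 0) →
      ∃ (y : ℝ → ℝ) (α β : ℕ → ℝ → ℝ),
        -- `y` is the unique solution in the sector, and it is positive
        (B.IsSolution p y ∧ y ∈ sector B.L (fun _ => 0) B.beta ∧
          (∀ x ∈ Set.Ioo 0 B.L, 0 < y x) ∧
          ∀ z, B.IsSolution p z → z ∈ sector B.L (fun _ => 0) B.beta →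
            Set.EqOn z y (Set.Icc 0 B.L)) ∧
        -- the two iterations are well defined
        B.IsTheIteration p (fun _ => 0) α ∧ B.IsTheIteration p B.beta β ∧
        -- they are monotone, together with their second derivatives
        (∀ k, ∀ x ∈ Set.Icc 0 B.L,
          (α k x ≤ α (k + 1) x ∧ α k x ≤ β k x ∧ β (k + 1) x ≤ β k x) ∧
          (derivOn B.L 2 (α (k + 1)) x ≤ derivOn B.L 2 (α k) x ∧
            derivOn B.L 2 (β k) x ≤ derivOn B.L 2 (α k) x ∧
            derivOn B.L 2 (β k) x ≤ derivOn B.L 2 (β (k + 1)) x)) ∧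
        -- both converge uniformly to `y`
        TendstoUniformlyOn α y Filter.atTop (Set.Icc 0 B.L) ∧
        TendstoUniformlyOn β y Filter.atTop (Set.Icc 0 B.L) := by
  obtain ⟨hl, hb, h⟩ := theorem6p1_general B n hn p hp_int hp_nonneg hp_le
  refine ⟨hl, hb, fun M N hM hN _ hle hp => ?_⟩
  obtain ⟨y, α, β, ⟨hy, hys, hpos, huniq⟩, hiter⟩ := h M N hM hN hle
  exact ⟨y, α, β, ⟨hy, hys, hpos hp, huniq⟩, hiter⟩
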